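/- Let $n\ge 0$ and let $B^n\subset\mathbb R^n$ be the open unit ball. For a finite set $I$ with $|I|\ge 2$ let $\mathcal F_n(I)$ be the Fulton--MacPherson space of $I$-labelled configurations of distinct points in $\mathbb R^n$ modulo translation and positive scaling, i.e. the closure of this configuration space in the compact space of all directions $\frac{x_i-x_j}{|x_i-x_j|}$ and all relative distances $\frac{|x_i-x_j|}{|x_i-x_k|}\in[0,\infty]$. For a nonempty finite set $I$ let $\mathcal F_{B^n}(I)$ be the closure of $\mathrm{Conf}(B^n,I)$ in the product of $(B^n)^I$ with the space of directions and relative distances. Grafting of infinitesimal configurations makes $\mathcal F_n$ a reduced operad and $\mathcal F_{B^n}$ a right $\mathcal F_n$-module. Adding disjoint basepoints gives an operad $(\mathcal F_n)_+$ in $(\mathrm{Top}_*,\wedge)$, and levelwise one-point compactification gives the right $(\mathcal F_n)_+$-module $\mathcal F_{(B^n)^+}$, $\mathcal F_{(B^n)^+}(I)=\mathcal F_{B^n}(I)^+$. Let $\mathrm{Triv}(\Sigma_1)$ be the trivial right $(\mathcal F_n)_+$-module which is $S^0$ on one-element sets and a point on all larger sets. There are pointed homeomorphisms $(B^n)^+\cong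 S^n$, and for each of them the identification \[\mathcal F_{(B^n)^+}(1)=(B^n)^+\cong S^n = S^n\wedge \mathrm{Triv}(\Sigma_1)(1)\] extends to exactly one map of right $(\mathcal F_n)_+$-modules \[f:\mathcal F_{(B^n)^+}\longrightarrow S^n\wedge \mathrm{Triv}(\Sigma_1).\] This map is a weak equivalence (that is, $f(I)$ is a weak homotopy equivalence for every nonempty finite set $I$), and it is $\otimes$-nice: for every $m\ge 1$ the tensor power $f^{\otimes m}$ is a weak equivalence, where $(R\otimes R')(K)=\bigvee_{K=I\sqcup J}R(I)\wedge R'(J)$ over decompositions of $K$ into two nonempty subsets. Moreover, $\mathcal F_{(B^n)^+}(I)$ is contractible whenever $|I|\ge 2$. -/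

import Mathlib

namespace FultonMacPherson

open Set Filter Topology Function
open scoped ENNReal

noncomputable section

/-! ## Pointed spaces -/

/-- Pointed topological spaces. -/
structure PtSpace where
  carrier : Type
  [top : TopologicalSpace carrier]
  base : carrier

attribute [instance] PtSpace.top

instance : CoeSort PtSpace Type := ⟨PtSpace.carrier⟩

/-- Continuous basepoint preserving maps. -/
structure PtMap (X Y : PtSpace) where
  toFun : X → Y
  cont : Continuous toFun
  map_base' : toFun X.base = Y.base

instance (X Y : PtSpace) : FunLike (PtMap X Y) X Y where
  coe := PtMap.toFun
  coe_injective f g h := by cases f; cases g; cases h; rfl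

@[ext] theorem PtMap.ext {X Y : PtSpace} {f g : PtMap X Y} (h : ∀ x, f x = g x) : f = g :=
  DFunLike.ext f g h

theorem PtMap.continuous {X Y : PtSpace} (f : PtMap X Y) : Continuous f := f.cont

theorem PtMap.map_base {X Y : PtSpace} (f : PtMap X Y) : f X.base = Y.base := f.map_base'

/-- The underlying continuous map of a pointed map. -/
def PtMap.toContinuousMap {X Y : PtSpace} (f : PtMap X Y) : C(X, Y) := ⟨f, f.continuous⟩

/-- Composition of pointed maps. -/
def PtMap.comp {X Y Z : PtSpace} (g : PtMap Y Z) (f : PtMap X Y) : PtMap X Z where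
  toFun x := g (f x)
  cont := g.continuous.comp f.continuous
  map_base' := by rw [f.map_base, g.map_base]

/-- The relation that collapses a subset `A` of `X` to one point. -/
def collapseSetoid {X : Type} (A : Set X) : Setoid X where
  r x y := x = y ∨ (x ∈ A ∧ y ∈ A)
  iseqv := by
    refine ⟨fun x => Or.inl rfl, ?_, ?_⟩
    · rintro x y (h | ⟨h, k⟩)
      · exact Or.inl h.symm
      · exact Or.inr ⟨k, h⟩
    · rintro x y z (rfl | ⟨h, k⟩) (rfl | ⟨h', k'⟩)
      · exact Or.inl rfl
      · exact Or.inr ⟨h', k'⟩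
      · exact Or.inr ⟨h, k⟩
      · exact Or.inr ⟨h, k'⟩

/-- The smash product `X ∧ Y = (X × Y) / (X ∨ Y)`, with the quotient topology. -/
def smash (X Y : PtSpace) : PtSpace where
  carrier := Quotient (collapseSetoid {p : X × Y | p.1 = X.base ∨ p.2 = Y.base})
  base := Quotient.mk _ (X.base, Y.base)

/-- The class of `(x, y)` in the smash product. -/
def smash.mk {X Y : PtSpace} (x : X) (y : Y) : smash X Y := Quotient.mk _ (x, y)

theorem smash.isQuotientMap (X Y : PtSpace) :
    IsQuotientMap (fun p : X × Y => smash.mk p.1 p.2) := isQuotientMap_quotient_mk'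

theorem smash.continuous_mk {X Y : PtSpace} :
    Continuous (fun p : X × Y => smash.mk p.1 p.2) := (smash.isQuotientMap X Y).continuous

theorem smash.ind {X Y : PtSpace} {P : smash X Y → Prop} (h : ∀ x y, P (smash.mk x y)) (z) :
    P z := Quotient.ind (fun p => h p.1 p.2) z

theorem smash.mk_base_left {X Y : PtSpace} (y : Y) :
    (smash.mk X.base y) = (smash X Y).base :=
  Quotient.sound (Or.inr ⟨Or.inl rfl, Or.inl rfl⟩)

theorem smash.mk_base_right {X Y : PtSpace} (x : X) :
    (smash.mk x Y.base) = (smash X Y).base :=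
  Quotient.sound (Or.inr ⟨Or.inr rfl, Or.inl rfl⟩)

/-- Pointed maps out of a smash product. -/
def smash.desc {X Y Z : PtSpace} (f : X → Y → Z) (hf : Continuous fun p : X × Y => f p.1 p.2)
    (hl : ∀ y, f X.base y = Z.base) (hr : ∀ x, f x Y.base = Z.base) : PtMap (smash X Y) Z where
  toFun := Quotient.lift (fun p : X × Y => f p.1 p.2) (by
    have key : ∀ p : X × Y, (p.1 = X.base ∨ p.2 = Y.base) → f p.1 p.2 = Z.base := by
      rintro ⟨x, y⟩ (h | h)
      · change x = _ at h; subst h; exact hl y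
      · change y = _ at h; subst h; exact hr x
    rintro p q (rfl | ⟨hp, hq⟩)
    · rfl
    · rw [key p hp, key q hq])
  cont := hf.quotient_lift _
  map_base' := hl _

@[simp] theorem smash.desc_mk {X Y Z : PtSpace} (f : X → Y → Z) (hf hl hr) (x : X) (y : Y) :
    smash.desc (Z := Z) f hf hl hr (smash.mk x y) = f x y := rfl

/-- The smash product of two pointed maps. -/
def smash.map {X X' Y Y' : PtSpace} (f : PtMap X X') (g : PtMap Y Y') :
    PtMap (smash X Y) (smash X' Y') :=
  smash.desc (fun x y => smash.mk (f x) (g y))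
    (smash.continuous_mk.comp
      ((f.continuous.comp continuous_fst).prodMk (g.continuous.comp continuous_snd)))
    (fun y => by rw [f.map_base, smash.mk_base_left])
    (fun x => by rw [g.map_base, smash.mk_base_right])

@[simp] theorem smash.map_mk {X X' Y Y' : PtSpace} (f : PtMap X X') (g : PtMap Y Y')
    (x : X) (y : Y) : smash.map f g (smash.mk x y) = smash.mk (f x) (g y) := rfl

/-- Pointed maps out of `(X ∧ Y) ∧ Z`; local compactness of `Z` makes `- × Z` preserve
quotient maps. -/
def smash.desc₃ {X Y Z W : PtSpace} [LocallyCompactSpace Z] (f : X → Y → Z → W)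
    (hf : Continuous fun p : (X × Y) × Z => f p.1.1 p.1.2 p.2)
    (h₁ : ∀ y z, f X.base y z = W.base) (h₂ : ∀ x z, f x Y.base z = W.base)
    (h₃ : ∀ x y, f x y Z.base = W.base) : PtMap (smash (smash X Y) Z) W :=
  smash.desc
    (fun u z => Quotient.lift (fun p : X × Y => f p.1 p.2 z) (by
      have key : ∀ p : X × Y, (p.1 = X.base ∨ p.2 = Y.base) → f p.1 p.2 z = W.base := by
        rintro ⟨x, y⟩ (h | h)
        · change x = _ at h; subst h; exact h₁ y z
        · change y = _ at h; subst h; exact h₂ x z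
      rintro p q (rfl | ⟨hp, hq⟩)
      · rfl
      · rw [key p hp, key q hq]) u)
    ((smash.isQuotientMap X Y).continuous_lift_prod_left hf)
    (fun z => h₁ _ z) (fun u => by
      induction u using smash.ind with
      | h x y => exact h₃ x y)

@[simp] theorem smash.desc₃_mk {X Y Z W : PtSpace} [LocallyCompactSpace Z] (f : X → Y → Z → W)
    (hf h₁ h₂ h₃) (x : X) (y : Y) (z : Z) :
    smash.desc₃ (W := W) f hf h₁ h₂ h₃ (smash.mk (smash.mk x y) z) = f x y z := rfl

/-- The wedge of a family of pointed spaces: the disjoint union of the spaces and of a point,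
with all the basepoints and this point identified. -/
def wedge {ι : Type} (X : ι → PtSpace) : PtSpace where
  carrier := Quotient (collapseSetoid
    (insert (Sum.inl ()) (range fun i => Sum.inr ⟨i, (X i).base⟩) : Set (Unit ⊕ Σ i, X i)))
  base := Quotient.mk _ (Sum.inl ())

/-- The inclusion of a summand into the wedge. -/
def wedge.incl {ι : Type} {X : ι → PtSpace} (i : ι) : PtMap (X i) (wedge X) where
  toFun x := Quotient.mk _ (Sum.inr ⟨i, x⟩)
  cont := continuous_quotient_mk'.comp
    (continuous_inr.comp (continuous_sigmaMk (σ := fun i => (X i).carrier)))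
  map_base' := Quotient.sound (Or.inr ⟨Or.inr ⟨i, rfl⟩, Or.inl rfl⟩)

theorem wedge.ind {ι : Type} {X : ι → PtSpace} {P : wedge X → Prop} (h0 : P (wedge X).base)
    (h : ∀ i x, P (wedge.incl i x)) (z) : P z := by
  refine Quotient.ind (fun p => ?_) z
  rcases p with ⟨⟩ | ⟨i, x⟩
  · exact h0
  · exact h i x

/-- Pointed maps out of a wedge. -/
def wedge.desc {ι : Type} {X : ι → PtSpace} {Z : PtSpace} (f : ∀ i, PtMap (X i) Z) :
    PtMap (wedge X) Z where
  toFun := Quotient.lift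
    (Sum.elim (fun _ => Z.base) (fun p : (Σ i, X i) => f p.1 p.2)) (by
    have key : ∀ p ∈ (insert (Sum.inl ()) (range fun i => Sum.inr ⟨i, (X i).base⟩) :
        Set (Unit ⊕ Σ i, X i)),
        Sum.elim (fun _ => Z.base) (fun p : (Σ i, X i) => f p.1 p.2) p = Z.base := by
      rintro p (rfl | ⟨i, rfl⟩)
      · rfl
      · exact (f i).map_base
    rintro p q (rfl | ⟨hp, hq⟩)
    · rfl
    · rw [key p hp, key q hq])
  cont := by
    refine Continuous.quotient_lift ?_ _
    exact continuous_const.sumElim (continuous_sigma fun i => (f i).continuous)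
  map_base' := rfl

@[simp] theorem wedge.desc_incl {ι : Type} {X : ι → PtSpace} {Z : PtSpace}
    (f : ∀ i, PtMap (X i) Z) (i : ι) (x : X i) : wedge.desc f (wedge.incl i x) = f i x := rfl

/-- The space of pointed maps, with the compact-open topology. -/
def ptHom (Y Z : PtSpace) : PtSpace where
  carrier := {f : C(Y, Z) // f Y.base = Z.base}
  base := ⟨ContinuousMap.const _ Z.base, rfl⟩

/-- Pointed maps out of `(⋁ i, X i) ∧ Z`. -/
def wedge.smashDesc {ι : Type} {X : ι → PtSpace} {Z W : PtSpace} [LocallyCompactSpace Z]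
    (f : ∀ i, PtMap (smash (X i) Z) W) : PtMap (smash (wedge X) Z) W :=
  let g : PtMap (wedge X) (ptHom Z W) := wedge.desc fun i =>
    { toFun := fun x => ⟨⟨fun z => f i (smash.mk x z), (f i).continuous.comp
          (smash.continuous_mk.comp (Continuous.prodMk_right x))⟩, by
          change f i (smash.mk x Z.base) = _
          rw [smash.mk_base_right, PtMap.map_base]⟩
      cont := Continuous.subtype_mk (ContinuousMap.curry
        ⟨fun p : X i × Z => f i (smash.mk p.1 p.2),
          (f i).continuous.comp smash.continuous_mk⟩).continuous _
      map_base' := by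
        apply Subtype.ext; ext z
        change f i (smash.mk _ z) = W.base
        rw [smash.mk_base_left, PtMap.map_base] }
  smash.desc (fun u z => (g u).1 z)
    (ContinuousEval.continuous_eval.comp
      (((continuous_subtype_val.comp g.continuous).comp continuous_fst).prodMk continuous_snd))
    (fun z => by rw [g.map_base]; rfl) (fun u => (g u).2)

@[simp] theorem wedge.smashDesc_mk {ι : Type} {X : ι → PtSpace} {Z W : PtSpace}
    [LocallyCompactSpace Z] (f : ∀ i, PtMap (smash (X i) Z) W) (i : ι) (x : X i) (z : Z) :
    wedge.smashDesc f (smash.mk (wedge.incl i x) z) = f i (smash.mk x z) := rfl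

/-- `X₊`: the space `X` with a disjoint basepoint. -/
def plus (X : Type) [TopologicalSpace X] : PtSpace where
  carrier := X ⊕ Unit
  base := Sum.inr ()

/-- `X⁺`: the one-point compactification, based at infinity. -/
def onePt (X : Type) [TopologicalSpace X] : PtSpace where
  carrier := OnePoint X
  base := OnePoint.infty

/-! ## Weak homotopy equivalences -/

/-- The map induced on path components. -/
def zerothHomotopyMap {X Y : Type} [TopologicalSpace X] [TopologicalSpace Y] (f : C(X, Y)) :
    ZerothHomotopy X → ZerothHomotopy Y :=
  Quotient.map' f (fun _ _ h => h.map f.continuous)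

/-- The map induced on the homotopy group (set, if `n = 0`) `π_n(X, x)`. -/
def homotopyGroupMap {X Y : Type} [TopologicalSpace X] [TopologicalSpace Y] (f : C(X, Y))
    (n : ℕ) (x : X) : HomotopyGroup (Fin n) X x → HomotopyGroup (Fin n) Y (f x) :=
  Quotient.map' (fun p => ⟨f.comp p.1, fun y hy => congrArg f (p.2 y hy)⟩)
    (fun _ _ h => h.comp_continuousMap f)

/-- Weak homotopy equivalences: bijective on path components, and on all homotopy groups at all
basepoints. -/
def IsWeakEquiv {X Y : Type} [TopologicalSpace X] [TopologicalSpace Y] (f : C(X, Y)) : Prop :=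
  Bijective (zerothHomotopyMap f) ∧ ∀ (n : ℕ) (x : X), Bijective (homotopyGroupMap f n x)


/-! ## Operads and right modules in pointed spaces -/

/-- The infinitesimal composite `I ∪_a J = (I - {a}) ⊔ J`. -/
abbrev Cup {I : Type} (a : I) (J : Type) : Type := {i : I // i ≠ a} ⊕ J

instance {I J : Type} (a : I) [Nontrivial J] : Nontrivial (Cup a J) :=
  (Sum.inr_injective (α := {i : I // i ≠ a}) (β := J)).nontrivial

/-- The projection `I ∪_a J → I` that sends `J` to `a`. -/
def Cup.proj {I J : Type} (a : I) : Cup a J → I := Sum.elim Subtype.val fun _ => a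

theorem Cup.proj_surjective {I J : Type} [Nonempty J] (a : I) :
    Surjective (Cup.proj (J := J) a) := by
  intro i
  by_cases h : i = a
  · exact ⟨Sum.inr (Classical.arbitrary J), h.symm⟩
  · exact ⟨Sum.inl ⟨i, h⟩, rfl⟩

/-- Functoriality of `I ∪_a J` in bijections. -/
def Cup.congr {I I' J J' : Type} (e : I ≃ I') (f : J ≃ J') {a : I} {a' : I'} (h : e a = a') :
    Cup a J ≃ Cup a' J' :=
  Equiv.sumCongr (e.subtypeEquiv fun i => by rw [← h, Ne, Ne, e.apply_eq_iff_eq]) f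

/-- The canonical bijection `(I ∪_a J) ∪_b L ≃ I ∪_a (J ∪_b L)` for `b ∈ J`. -/
def Cup.seq {I J : Type} (L : Type) (a : I) (b : J) :
    Cup (Sum.inr b : Cup a J) L ≃ Cup a (Cup b L) where
  toFun
    | .inl ⟨.inl i, _⟩ => .inl i
    | .inl ⟨.inr j, h⟩ => .inr (.inl ⟨j, fun k => h (congrArg Sum.inr k)⟩)
    | .inr l => .inr (.inr l)
  invFun
    | .inl i => .inl ⟨.inl i, Sum.inl_ne_inr⟩
    | .inr (.inl j) => .inl ⟨.inr j.1, fun k => j.2 (Sum.inr_injective k)⟩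
    | .inr (.inr l) => .inr l
  left_inv := by rintro (⟨i | j, h⟩ | l) <;> rfl
  right_inv := by rintro (i | j | l) <;> rfl

/-- The canonical bijection `(I ∪_a J) ∪_{a'} L ≃ (I ∪_{a'} L) ∪_a J` for `a ≠ a'` in `I`. -/
def Cup.par {I : Type} (J L : Type) {a a' : I} (h : a ≠ a') :
    Cup (Sum.inl ⟨a', h.symm⟩ : Cup a J) L ≃ Cup (Sum.inl ⟨a, h⟩ : Cup a' L) J where
  toFun
    | .inl ⟨.inl i, hi⟩ => .inl ⟨.inl ⟨i.1, fun k => hi (congrArg Sum.inl (Subtype.ext k))⟩,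
        fun k => i.2 (congrArg Subtype.val (Sum.inl_injective k))⟩
    | .inl ⟨.inr j, _⟩ => .inr j
    | .inr l => .inl ⟨.inr l, Sum.inr_ne_inl⟩
  invFun
    | .inl ⟨.inl i, hi⟩ => .inl ⟨.inl ⟨i.1, fun k => hi (congrArg Sum.inl (Subtype.ext k))⟩,
        fun k => i.2 (congrArg Subtype.val (Sum.inl_injective k))⟩
    | .inl ⟨.inr l, _⟩ => .inr l
    | .inr j => .inl ⟨.inr j, Sum.inr_ne_inl⟩
  left_inv := by rintro (⟨i | j, h⟩ | l) <;> rfl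
  right_inv := by rintro (⟨i | j, h⟩ | l) <;> rfl

/-- Reduced operads in pointed spaces with the smash product. Since `O(I)` is the unit and the
partial composites with it are identities for `|I| = 1`, only the data for `|I| ≥ 2` are
recorded. -/
structure PtOperad where
  obj : (I : Type) → [Finite I] → [Nontrivial I] → PtSpace
  map : {I I' : Type} → [Finite I] → [Nontrivial I] → [Finite I'] → [Nontrivial I'] →
    (I ≃ I') → PtMap (obj I) (obj I')
  map_refl : ∀ (I : Type) [Finite I] [Nontrivial I] (x : obj I), map (Equiv.refl I) x = x
  map_trans : ∀ {I I' I'' : Type} [Finite I] [Nontrivial I] [Finite I'] [Nontrivial I']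
    [Finite I''] [Nontrivial I''] (e : I ≃ I') (f : I' ≃ I'') (x : obj I),
    map (e.trans f) x = map f (map e x)
  comp : {I J : Type} → [Finite I] → [Nontrivial I] → [Finite J] → [Nontrivial J] → (a : I) →
    PtMap (smash (obj I) (obj J)) (obj (Cup a J))
  map_comp : ∀ {I I' J J' : Type} [Finite I] [Nontrivial I] [Finite I'] [Nontrivial I']
    [Finite J] [Nontrivial J] [Finite J'] [Nontrivial J'] (e : I ≃ I') (f : J ≃ J')
    {a : I} {a' : I'} (h : e a = a') (x : obj I) (y : obj J),
    map (Cup.congr e f h) (comp a (smash.mk x y)) = comp a' (smash.mk (map e x) (map f y))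
  assoc_seq : ∀ {I J L : Type} [Finite I] [Nontrivial I] [Finite J] [Nontrivial J]
    [Finite L] [Nontrivial L] (a : I) (b : J) (x : obj I) (y : obj J) (z : obj L),
    map (Cup.seq L a b) (comp (Sum.inr b : Cup a J) (smash.mk (comp a (smash.mk x y)) z)) =
      comp a (smash.mk x (comp b (smash.mk y z)))
  assoc_par : ∀ {I J L : Type} [Finite I] [Nontrivial I] [Finite J] [Nontrivial J]
    [Finite L] [Nontrivial L] {a a' : I} (h : a ≠ a') (x : obj I) (y : obj J) (z : obj L),
    map (Cup.par J L h)
        (comp (Sum.inl ⟨a', h.symm⟩ : Cup a J) (smash.mk (comp a (smash.mk x y)) z)) =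
      comp (Sum.inl ⟨a, h⟩ : Cup a' L) (smash.mk (comp a' (smash.mk x z)) y)

/-- The spaces of the operad are locally compact. In the category of all topological spaces this
is what makes the functors `- ∧ O(J)` preserve colimits. -/
class PtOperad.LocCompact (O : PtOperad) : Prop where
  out : ∀ (J : Type) [Finite J] [Nontrivial J], LocallyCompactSpace (O.obj J)

instance (O : PtOperad) [h : O.LocCompact] (J : Type) [Finite J] [Nontrivial J] :
    LocallyCompactSpace (O.obj J) := h.out J

/-- Symmetric sequences of pointed spaces: functors on the groupoid of nonempty finite sets. -/
structure SymSeq where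
  obj : (I : Type) → [Finite I] → [Nonempty I] → PtSpace
  map : {I I' : Type} → [Finite I] → [Nonempty I] → [Finite I'] → [Nonempty I'] →
    (I ≃ I') → PtMap (obj I) (obj I')
  map_refl : ∀ (I : Type) [Finite I] [Nonempty I] (x : obj I), map (Equiv.refl I) x = x
  map_trans : ∀ {I I' I'' : Type} [Finite I] [Nonempty I] [Finite I'] [Nonempty I']
    [Finite I''] [Nonempty I''] (e : I ≃ I') (f : I' ≃ I'') (x : obj I),
    map (e.trans f) x = map f (map e x)

/-- Right modules over a reduced operad in pointed spaces. -/
structure RMod (O : PtOperad) extends SymSeq where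
  comp : {I J : Type} → [Finite I] → [Nonempty I] → [Finite J] → [Nontrivial J] → (a : I) →
    PtMap (smash (obj I) (O.obj J)) (obj (Cup a J))
  map_comp : ∀ {I I' J J' : Type} [Finite I] [Nonempty I] [Finite I'] [Nonempty I']
    [Finite J] [Nontrivial J] [Finite J'] [Nontrivial J'] (e : I ≃ I') (f : J ≃ J')
    {a : I} {a' : I'} (h : e a = a') (x : obj I) (y : O.obj J),
    map (Cup.congr e f h) (comp a (smash.mk x y)) = comp a' (smash.mk (map e x) (O.map f y))
  assoc_seq : ∀ {I J L : Type} [Finite I] [Nonempty I] [Finite J] [Nontrivial J]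
    [Finite L] [Nontrivial L] (a : I) (b : J) (x : obj I) (y : O.obj J) (z : O.obj L),
    map (Cup.seq L a b) (comp (Sum.inr b : Cup a J) (smash.mk (comp a (smash.mk x y)) z)) =
      comp a (smash.mk x (O.comp b (smash.mk y z)))
  assoc_par : ∀ {I J L : Type} [Finite I] [Nonempty I] [Finite J] [Nontrivial J]
    [Finite L] [Nontrivial L] {a a' : I} (h : a ≠ a') (x : obj I) (y : O.obj J) (z : O.obj L),
    map (Cup.par J L h)
        (comp (Sum.inl ⟨a', h.symm⟩ : Cup a J) (smash.mk (comp a (smash.mk x y)) z)) =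
      comp (Sum.inl ⟨a, h⟩ : Cup a' L) (smash.mk (comp a' (smash.mk x z)) y)

/-- Morphisms of right modules. -/
structure RMod.Hom {O : PtOperad} (R R' : RMod O) where
  app : (I : Type) → [Finite I] → [Nonempty I] → PtMap (R.obj I) (R'.obj I)
  naturality : ∀ {I I' : Type} [Finite I] [Nonempty I] [Finite I'] [Nonempty I'] (e : I ≃ I')
    (x : R.obj I), app I' (R.map e x) = R'.map e (app I x)
  app_comp : ∀ {I J : Type} [Finite I] [Nonempty I] [Finite J] [Nontrivial J] (a : I)
    (x : R.obj I) (y : O.obj J),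
    app (Cup a J) (R.comp a (smash.mk x y)) = R'.comp a (smash.mk (app I x) y)

/-- Weak equivalences of right modules are the levelwise weak equivalences. -/
def RMod.Hom.IsWeakEquiv {O : PtOperad} {R R' : RMod O} (f : R.Hom R') : Prop :=
  ∀ (I : Type) [Finite I] [Nonempty I],
    FultonMacPherson.IsWeakEquiv (f.app I).toContinuousMap

/-- The symmetric sequence `Σ_i`, with a disjoint basepoint, concentrated in degree `i`: the
discrete space of bijections `{1, …, i} ≃ I`, with a disjoint basepoint. -/
def sigmaSeq (i : ℕ) : SymSeq where
  obj I := letI : TopologicalSpace (Fin i ≃ I) := ⊥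
    plus (Fin i ≃ I)
  map {I I'} _ _ _ _ e := letI : TopologicalSpace (Fin i ≃ I) := ⊥
    letI : TopologicalSpace (Fin i ≃ I') := ⊥
    haveI : DiscreteTopology (Fin i ≃ I) := ⟨rfl⟩
    { toFun := Sum.map (fun u => u.trans e) id
      cont := continuous_of_discreteTopology.sumMap continuous_id
      map_base' := rfl }
  map_refl _ _ _ x := by rcases x with x | x <;> rfl
  map_trans _ _ x := by rcases x with x | x <;> rfl

/-- The trivial right module on a symmetric sequence, that is, its restriction along the
augmentation of the operad: the partial composites with `O(J)`, `|J| ≥ 2`, are trivial. -/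
def RMod.triv (O : PtOperad) (X : SymSeq) : RMod O where
  toSymSeq := X
  comp {_ J} _ _ _ _ a :=
    { toFun := fun _ => (X.obj (Cup a J)).base
      cont := continuous_const
      map_base' := rfl }
  map_comp _ _ _ _ _ _ _ := (X.map _).map_base
  assoc_seq _ _ _ _ _ := (X.map _).map_base
  assoc_par _ _ _ _ := (X.map _).map_base

/-- The right module `X ∧ R`, for a pointed space `X`. -/
def RMod.smashLeft {O : PtOperad} [O.LocCompact] (X : PtSpace) (R : RMod O) : RMod O where
  obj I := smash X (R.obj I)
  map e := smash.map ⟨id, continuous_id, rfl⟩ (R.map e)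
  map_refl I _ _ x := by
    induction x using smash.ind with
    | h x y => exact congrArg (smash.mk x) (R.map_refl I y)
  map_trans e f x := by
    induction x using smash.ind with
    | h x y => exact congrArg (smash.mk x) (R.map_trans e f y)
  comp a := smash.desc₃ (fun x r y => smash.mk x (R.comp a (smash.mk r y)))
    (smash.continuous_mk.comp ((continuous_fst.comp continuous_fst).prodMk
      ((R.comp a).continuous.comp (smash.continuous_mk.comp
        ((continuous_snd.comp continuous_fst).prodMk continuous_snd)))))
    (fun r y => smash.mk_base_left _)
    (fun x y => by rw [smash.mk_base_left, PtMap.map_base, smash.mk_base_right])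
    (fun x r => by rw [smash.mk_base_right, PtMap.map_base, smash.mk_base_right])
  map_comp e f a a' h x y := by
    induction x using smash.ind with
    | h x r => exact congrArg (smash.mk x) (R.map_comp e f h r y)
  assoc_seq a b x y z := by
    induction x using smash.ind with
    | h x r => exact congrArg (smash.mk x) (R.assoc_seq a b r y z)
  assoc_par h x y z := by
    induction x using smash.ind with
    | h x r => exact congrArg (smash.mk x) (R.assoc_par h r y z)

/-! ## The tensor product of right modules -/

/-- Decompositions `K = I ⊔ J` into nonempty subsets, given by the predicate that cuts out `I`. -/
structure Decomp (K : Type) where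
  S : K → Prop
  exL : ∃ k, S k
  exR : ∃ k, ¬ S k

/-- The left part of a decomposition. -/
abbrev Decomp.L {K : Type} (D : Decomp K) : Type := {k : K // D.S k}

/-- The right part of a decomposition. -/
abbrev Decomp.R {K : Type} (D : Decomp K) : Type := {k : K // ¬ D.S k}

instance {K : Type} (D : Decomp K) : Nonempty D.L := D.exL.elim fun k h => ⟨⟨k, h⟩⟩

instance {K : Type} (D : Decomp K) : Nonempty D.R := D.exR.elim fun k h => ⟨⟨k, h⟩⟩

/-- The preimage of a decomposition under a surjection. -/
def Decomp.pull {K K' : Type} (q : K' → K) (hq : Surjective q) (D : Decomp K) : Decomp K' where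
  S k := D.S (q k)
  exL := D.exL.elim fun k h => (hq k).elim fun k' h' => ⟨k', h'.symm ▸ h⟩
  exR := D.exR.elim fun k h => (hq k).elim fun k' h' => ⟨k', h'.symm ▸ h⟩

/-- The spaces `⋁_{K = I ⊔ J} R(I) ∧ R'(J)` of the tensor product. -/
def tensorObj (R R' : SymSeq) (K : Type) [Finite K] : PtSpace :=
  wedge fun D : Decomp K => smash (R.obj D.L) (R'.obj D.R)

/-- The class of `x ∧ y` in the summand of a decomposition. -/
def tmk {R R' : SymSeq} {K : Type} [Finite K] (D : Decomp K) (x : R.obj D.L) (y : R'.obj D.R) :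
    tensorObj R R' K :=
  wedge.incl (X := fun D : Decomp K => smash (R.obj D.L) (R'.obj D.R)) D (smash.mk x y)

theorem tmk_ind {R R' : SymSeq} {K : Type} [Finite K] {P : tensorObj R R' K → Prop}
    (h0 : P (tensorObj R R' K).base) (h : ∀ D x y, P (tmk D x y)) (z) : P z :=
  wedge.ind h0 (fun D x => smash.ind (P := fun u => P (wedge.incl D u)) (h D) x) z

theorem tmk_base_left {R R' : SymSeq} {K : Type} [Finite K] (D : Decomp K) (y : R'.obj D.R) :
    tmk D (R.obj D.L).base y = (tensorObj R R' K).base := by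
  unfold tmk
  rw [smash.mk_base_left, PtMap.map_base]
  rfl

theorem tmk_base_right {R R' : SymSeq} {K : Type} [Finite K] (D : Decomp K) (x : R.obj D.L) :
    tmk D x (R'.obj D.R).base = (tensorObj R R' K).base := by
  unfold tmk
  rw [smash.mk_base_right, PtMap.map_base]
  rfl

theorem continuous_tmk {R R' : SymSeq} {K : Type} [Finite K] (D : Decomp K) :
    Continuous fun p : R.obj D.L × R'.obj D.R => (tmk D p.1 p.2 : tensorObj R R' K) :=
  (PtMap.continuous _).comp smash.continuous_mk

theorem tmk_congr {R R' : SymSeq} {K A B : Type} [Finite K] [Finite A] [Nonempty A] [Finite B]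
    [Nonempty B] {D D' : Decomp K} (hD : ∀ k, D.S k ↔ D'.S k) (e : A ≃ D.L) (e' : A ≃ D'.L)
    (f : B ≃ D.R) (f' : B ≃ D'.R) (he : ∀ a, (e a).1 = (e' a).1) (hf : ∀ b, (f b).1 = (f' b).1)
    (x : R.obj A) (y : R'.obj B) :
    (tmk D (R.map e x) (R'.map f y) : tensorObj R R' K) = tmk D' (R.map e' x) (R'.map f' y) := by
  obtain ⟨S, h1, h2⟩ := D
  obtain ⟨S', h1', h2'⟩ := D'
  obtain rfl : S = S' := funext fun k => propext (hD k)
  obtain rfl : e = e' := Equiv.ext fun a => Subtype.ext (he a)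
  obtain rfl : f = f' := Equiv.ext fun b => Subtype.ext (hf b)
  rfl

/-- The bijection between the left parts induced by a relabeling. -/
def Decomp.equivL {K K' : Type} (e : K ≃ K') (D : Decomp K) :
    D.L ≃ (D.pull e.symm e.symm.surjective).L :=
  e.subtypeEquiv fun k => by simp [Decomp.pull]

/-- The bijection between the right parts induced by a relabeling. -/
def Decomp.equivR {K K' : Type} (e : K ≃ K') (D : Decomp K) :
    D.R ≃ (D.pull e.symm e.symm.surjective).R :=
  e.subtypeEquiv fun k => by simp [Decomp.pull]

/-- The relabeling maps of the tensor product. -/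
def tensorMap (R R' : SymSeq) {K K' : Type} [Finite K] [Finite K'] (e : K ≃ K') :
    PtMap (tensorObj R R' K) (tensorObj R R' K') :=
  wedge.desc fun D => smash.desc
    (fun x y => tmk (D.pull e.symm e.symm.surjective) (R.map (D.equivL e) x)
      (R'.map (D.equivR e) y))
    ((continuous_tmk _).comp (((PtMap.continuous _).comp continuous_fst).prodMk
      ((PtMap.continuous _).comp continuous_snd)))
    (fun y => by rw [PtMap.map_base, tmk_base_left])
    (fun x => by rw [PtMap.map_base, tmk_base_right])

theorem tensorMap_tmk (R R' : SymSeq) {K K' : Type} [Finite K] [Finite K'] (e : K ≃ K')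
    (D : Decomp K) (x : R.obj D.L) (y : R'.obj D.R) :
    tensorMap R R' e (tmk D x y) = tmk (D.pull e.symm e.symm.surjective)
      (R.map (D.equivL e) x) (R'.map (D.equivR e) y) := rfl

/-- The tensor product of symmetric sequences. -/
def tensorSeq (R R' : SymSeq) : SymSeq where
  obj K := tensorObj R R' K
  map e := tensorMap R R' e
  map_refl K _ _ z := by
    induction z using tmk_ind with
    | h0 => exact PtMap.map_base _
    | h D x y =>
      have := tmk_congr (R := R) (R' := R') (D := D.pull _ (Equiv.refl K).symm.surjective)
        (D' := D) (fun k => Iff.rfl) (D.equivL (.refl K)) (.refl _) (D.equivR (.refl K)) (.refl _)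
        (fun _ => rfl) (fun _ => rfl) x y
      rw [R.map_refl, R'.map_refl] at this
      exact this
  map_trans e f z := by
    induction z using tmk_ind with
    | h0 => rw [PtMap.map_base, PtMap.map_base, PtMap.map_base]
    | h D x y =>
      have := tmk_congr (R := R) (R' := R') (D := D.pull _ (e.trans f).symm.surjective)
        (D' := (D.pull _ e.symm.surjective).pull _ f.symm.surjective) (fun k => Iff.rfl)
        (D.equivL (e.trans f)) ((D.equivL e).trans (Decomp.equivL f _))
        (D.equivR (e.trans f)) ((D.equivR e).trans (Decomp.equivR f _))
        (fun _ => rfl) (fun _ => rfl) x y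
      rw [R.map_trans, R'.map_trans] at this
      exact this

/-- `S ∪_a J` is the preimage of `S` in `K ∪_a J`, if `a ∈ S`. -/
def cupIn {K : Type} (J : Type) {S : K → Prop} {a : K} (h : S a) :
    Cup (⟨a, h⟩ : {k // S k}) J ≃ {p : Cup a J // S (Cup.proj a p)} where
  toFun
    | .inl i => ⟨.inl ⟨i.1.1, fun k => i.2 (Subtype.ext k)⟩, i.1.2⟩
    | .inr j => ⟨.inr j, h⟩
  invFun
    | ⟨.inl i, hi⟩ => .inl ⟨⟨i.1, hi⟩, fun k => i.2 (congrArg Subtype.val k)⟩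
    | ⟨.inr j, _⟩ => .inr j
  left_inv := by rintro (i | j) <;> rfl
  right_inv := by rintro ⟨i | j, h⟩ <;> rfl

/-- `S` is its own preimage in `K ∪_a J`, if `a ∉ S`. -/
def cupOut {K : Type} (J : Type) {S : K → Prop} {a : K} (h : ¬ S a) :
    {k // S k} ≃ {p : Cup a J // S (Cup.proj a p)} where
  toFun i := ⟨.inl ⟨i.1, fun k => h (k ▸ i.2)⟩, i.2⟩
  invFun
    | ⟨.inl i, hi⟩ => ⟨i.1, hi⟩
    | ⟨.inr _, hj⟩ => absurd hj h
  left_inv _ := rfl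
  right_inv := by
    rintro ⟨i | j, hj⟩
    · rfl
    · exact absurd hj h

/-- The decomposition of `K ∪_a J` induced by one of `K`. -/
abbrev Decomp.cup {K : Type} (J : Type) [Nonempty J] (a : K) (D : Decomp K) : Decomp (Cup a J) :=
  D.pull (Cup.proj a) (Cup.proj_surjective a)

/-- The left part of the induced decomposition, if `a` is in the left part. -/
def Decomp.inL {K : Type} (J : Type) [Nonempty J] {a : K} (D : Decomp K) (h : D.S a) :
    Cup (⟨a, h⟩ : D.L) J ≃ (D.cup J a).L := cupIn J h

/-- The right part of the induced decomposition, if `a` is in the right part. -/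
def Decomp.inR {K : Type} (J : Type) [Nonempty J] {a : K} (D : Decomp K) (h : ¬ D.S a) :
    Cup (⟨a, h⟩ : D.R) J ≃ (D.cup J a).R := cupIn (S := fun k => ¬ D.S k) J h

/-- The left part of the induced decomposition, if `a` is in the right part. -/
def Decomp.outL {K : Type} (J : Type) [Nonempty J] {a : K} (D : Decomp K) (h : ¬ D.S a) :
    D.L ≃ (D.cup J a).L := cupOut J h

/-- The right part of the induced decomposition, if `a` is in the left part. -/
def Decomp.outR {K : Type} (J : Type) [Nonempty J] {a : K} (D : Decomp K) (h : D.S a) :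
    D.R ≃ (D.cup J a).R := cupOut (S := fun k => ¬ D.S k) J (not_not_intro h)

open Classical in
/-- The partial composites of the tensor product: on the summand of `K = I ⊔ I'` they are the
partial composites of the factor whose index set contains `a`. -/
def tensorComp {O : PtOperad} [O.LocCompact] (R R' : RMod O) {K J : Type} [Finite K]
    [Finite J] [Nontrivial J] (a : K) :
    PtMap (smash (tensorObj R.toSymSeq R'.toSymSeq K) (O.obj J))
      (tensorObj R.toSymSeq R'.toSymSeq (Cup a J)) :=
  wedge.smashDesc fun D =>
    if h : D.S a then
      smash.desc₃ (fun x y z => tmk (D.cup J a)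
          (R.map (D.inL J h) (R.comp (⟨a, h⟩ : D.L) (smash.mk x z)))
          (R'.map (D.outR J h) y))
        ((continuous_tmk _).comp (((PtMap.continuous _).comp ((PtMap.continuous _).comp
          (smash.continuous_mk.comp ((continuous_fst.comp continuous_fst).prodMk
            continuous_snd)))).prodMk
          ((PtMap.continuous _).comp (continuous_snd.comp continuous_fst))))
        (fun y z => by
          rw [smash.mk_base_left, PtMap.map_base, PtMap.map_base, tmk_base_left])
        (fun x z => by rw [PtMap.map_base, tmk_base_right])
        (fun x y => by
          rw [smash.mk_base_right, PtMap.map_base, PtMap.map_base, tmk_base_left])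
    else
      smash.desc₃ (fun x y z => tmk (D.cup J a)
          (R.map (D.outL J h) x)
          (R'.map (D.inR J h)
            (R'.comp (⟨a, h⟩ : D.R) (smash.mk y z))))
        ((continuous_tmk _).comp (((PtMap.continuous _).comp
          (continuous_fst.comp continuous_fst)).prodMk
          ((PtMap.continuous _).comp ((PtMap.continuous _).comp
          (smash.continuous_mk.comp ((continuous_snd.comp continuous_fst).prodMk
            continuous_snd))))))
        (fun y z => by rw [PtMap.map_base, tmk_base_left])
        (fun x z => by
          rw [smash.mk_base_left, PtMap.map_base, PtMap.map_base, tmk_base_right])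
        (fun x y => by
          rw [smash.mk_base_right, PtMap.map_base, PtMap.map_base, tmk_base_right])

theorem tensorComp_left {O : PtOperad} [O.LocCompact] (R R' : RMod O) {K J : Type} [Finite K]
    [Finite J] [Nontrivial J] (a : K) (D : Decomp K) (h : D.S a) (x : R.obj D.L)
    (y : R'.obj D.R) (z : O.obj J) :
    tensorComp R R' a (smash.mk (tmk D x y) z) = tmk (D.cup J a)
      (R.map (D.inL J h) (R.comp (⟨a, h⟩ : D.L) (smash.mk x z)))
      (R'.map (D.outR J h) y) := by
  exact congrArg (fun F : PtMap _ _ => F (smash.mk (smash.mk x y) z)) (dif_pos h)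

theorem tensorComp_right {O : PtOperad} [O.LocCompact] (R R' : RMod O) {K J : Type} [Finite K]
    [Finite J] [Nontrivial J] (a : K) (D : Decomp K) (h : ¬ D.S a) (x : R.obj D.L)
    (y : R'.obj D.R) (z : O.obj J) :
    tensorComp R R' a (smash.mk (tmk D x y) z) = tmk (D.cup J a) (R.map (D.outL J h) x)
      (R'.map (D.inR J h)
        (R'.comp (⟨a, h⟩ : D.R) (smash.mk y z))) := by
  exact congrArg (fun F : PtMap _ _ => F (smash.mk (smash.mk x y) z)) (dif_neg h)

/-- The tensor product of right modules,
`(R ⊗ R')(K) = ⋁_{K = I ⊔ J} R(I) ∧ R'(J)`, with `I` and `J` nonempty. -/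
def RMod.tensor {O : PtOperad} [O.LocCompact] (R R' : RMod O) : RMod O where
  toSymSeq := tensorSeq R.toSymSeq R'.toSymSeq
  comp a := tensorComp R R' a
  map_comp {I I' J J'} _ _ _ _ _ _ _ _ e f a a' h x w := by
    change tensorMap _ _ _ (tensorComp R R' a (smash.mk x w)) =
      tensorComp R R' a' (smash.mk (tensorMap _ _ e x) (O.map f w))
    subst h
    induction x using tmk_ind with
    | h0 => simp only [smash.mk_base_left, PtMap.map_base]
    | h D x y =>
      have hS : ∀ p, (D.cup J a).S ((Cup.congr e f rfl).symm p) ↔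
          ((D.pull e.symm e.symm.surjective).cup J' (e a)).S p := by
        rintro (p | p)
        · rfl
        · exact iff_of_eq (congrArg D.S (e.symm_apply_apply a).symm)
      by_cases h : D.S a
      · have h' : (D.pull e.symm e.symm.surjective).S (e a) := (hS (.inr (f (Classical.arbitrary J)))).1 h
        rw [tensorComp_left R R' a D h, tensorMap_tmk, tensorMap_tmk,
          tensorComp_left R R' (e a) _ h', ← R.map_comp (D.equivL e) f (a := ⟨a, h⟩) (a' := ⟨e a, h'⟩) rfl,
          ← R.map_trans, ← R.map_trans, ← R'.map_trans, ← R'.map_trans]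
        refine tmk_congr hS _ _ _ _ ?_ ?_ _ _
        · rintro (i | j) <;> rfl
        · intro i; rfl
      · have h' : ¬ (D.pull e.symm e.symm.surjective).S (e a) := fun k => h ((hS (.inr (f (Classical.arbitrary J)))).2 k)
        rw [tensorComp_right R R' a D h, tensorMap_tmk, tensorMap_tmk,
          tensorComp_right R R' (e a) _ h', ← R'.map_comp (D.equivR e) f (a := ⟨a, h⟩) (a' := ⟨e a, h'⟩) rfl,
          ← R.map_trans, ← R.map_trans, ← R'.map_trans, ← R'.map_trans]
        refine tmk_congr hS _ _ _ _ ?_ ?_ _ _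
        · intro i; rfl
        · rintro (i | j) <;> rfl
  assoc_seq {I J L} _ _ _ _ _ _ a b x w z := by
    change tensorMap _ _ _ (tensorComp R R' (Sum.inr b : Cup a J)
      (smash.mk (tensorComp R R' a (smash.mk x w)) z)) =
      tensorComp R R' a (smash.mk x (O.comp b (smash.mk w z)))
    induction x using tmk_ind with
    | h0 => simp only [smash.mk_base_left, PtMap.map_base]
    | h D x y =>
      have hS : ∀ p, ((D.cup J a).cup L (Sum.inr b)).S ((Cup.seq L a b).symm p) ↔
          (D.cup (Cup b L) a).S p := by
        rintro (p | p | p) <;> rfl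
      by_cases h : D.S a
      · have e1 := R.map_comp (D.inL J h) (Equiv.refl L) (a := Sum.inr b)
          (a' := ⟨Sum.inr b, h⟩) rfl (R.comp ⟨a, h⟩ (smash.mk x w)) z
        have e2 := R.assoc_seq (⟨a, h⟩ : D.L) b x w z
        rw [O.map_refl] at e1
        rw [tensorComp_left R R' a D h, tensorComp_left R R' _ _ (show (D.cup J a).S (Sum.inr b) from h),
          tensorComp_left R R' a D h, tensorMap_tmk, ← e1, ← e2]
        simp only [← R.map_trans, ← R'.map_trans]
        refine tmk_congr hS _ _ _ _ ?_ ?_ _ _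
        · rintro (⟨i | j, hj⟩ | j) <;> rfl
        · intro i; rfl
      · have e1 := R'.map_comp (D.inR J h) (Equiv.refl L) (a := Sum.inr b)
          (a' := ⟨Sum.inr b, h⟩) rfl (R'.comp ⟨a, h⟩ (smash.mk y w)) z
        have e2 := R'.assoc_seq (⟨a, h⟩ : D.R) b y w z
        rw [O.map_refl] at e1
        rw [tensorComp_right R R' a D h, tensorComp_right R R' _ _ (show ¬ (D.cup J a).S (Sum.inr b) from h),
          tensorComp_right R R' a D h, tensorMap_tmk, ← e1, ← e2]
        simp only [← R.map_trans, ← R'.map_trans]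
        refine tmk_congr hS _ _ _ _ ?_ ?_ _ _
        · intro i; rfl
        · rintro (⟨i | j, hj⟩ | j) <;> rfl
  assoc_par {I J L} _ _ _ _ _ _ a a' ha x w z := by
    change tensorMap _ _ _ (tensorComp R R' (Sum.inl ⟨a', ha.symm⟩ : Cup a J)
      (smash.mk (tensorComp R R' a (smash.mk x w)) z)) =
      tensorComp R R' (Sum.inl ⟨a, ha⟩ : Cup a' L)
        (smash.mk (tensorComp R R' a' (smash.mk x z)) w)
    induction x using tmk_ind with
    | h0 => simp only [smash.mk_base_left, PtMap.map_base]
    | h D x y =>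
      have hS : ∀ p, ((D.cup J a).cup L (Sum.inl ⟨a', ha.symm⟩)).S ((Cup.par J L ha).symm p) ↔
          ((D.cup L a').cup J (Sum.inl ⟨a, ha⟩)).S p := by
        rintro (⟨p | p, hp⟩ | p) <;> rfl
      by_cases h : D.S a <;> by_cases h' : D.S a'
      · have hne : (⟨a, h⟩ : D.L) ≠ ⟨a', h'⟩ := fun k => ha (congrArg Subtype.val k)
        have e1 := R.map_comp (D.inL J h) (Equiv.refl L) (a := Sum.inl ⟨⟨a', h'⟩, hne.symm⟩)
          (a' := ⟨Sum.inl ⟨a', ha.symm⟩, h'⟩) rfl (R.comp ⟨a, h⟩ (smash.mk x w)) z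
        have e2 := R.map_comp (D.inL L h') (Equiv.refl J) (a := Sum.inl ⟨⟨a, h⟩, hne⟩)
          (a' := ⟨Sum.inl ⟨a, ha⟩, h⟩) rfl (R.comp ⟨a', h'⟩ (smash.mk x z)) w
        have e3 := R.assoc_par hne x w z
        rw [O.map_refl] at e1 e2
        rw [tensorComp_left R R' a D h, tensorComp_left R R' _ _ (show (D.cup J a).S (Sum.inl ⟨a', ha.symm⟩) from h'),
          tensorComp_left R R' a' D h', tensorComp_left R R' _ _ (show (D.cup L a').S (Sum.inl ⟨a, ha⟩) from h),
          tensorMap_tmk, ← e1, ← e2, ← e3]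
        simp only [← R.map_trans, ← R'.map_trans]
        refine tmk_congr hS _ _ _ _ ?_ ?_ _ _
        · rintro (⟨i | j, hj⟩ | j) <;> rfl
        · intro i; rfl
      · have e1 := R.map_comp (D.outL L h') (Equiv.refl J) (a := ⟨a, h⟩)
          (a' := ⟨Sum.inl ⟨a, ha⟩, h⟩) rfl x w
        have e2 := R'.map_comp (D.outR J h) (Equiv.refl L) (a := ⟨a', h'⟩)
          (a' := ⟨Sum.inl ⟨a', ha.symm⟩, h'⟩) rfl y z
        rw [O.map_refl] at e1 e2
        rw [tensorComp_left R R' a D h, tensorComp_right R R' _ _ (show ¬ (D.cup J a).S (Sum.inl ⟨a', ha.symm⟩) from h'),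
          tensorComp_right R R' a' D h', tensorComp_left R R' _ _ (show (D.cup L a').S (Sum.inl ⟨a, ha⟩) from h),
          tensorMap_tmk, ← e1, ← e2]
        simp only [← R.map_trans, ← R'.map_trans]
        refine tmk_congr hS _ _ _ _ ?_ ?_ _ _
        · rintro (i | j) <;> rfl
        · rintro (i | j) <;> rfl
      · have e1 := R'.map_comp (D.outR L h') (Equiv.refl J) (a := ⟨a, h⟩)
          (a' := ⟨Sum.inl ⟨a, ha⟩, h⟩) rfl y w
        have e2 := R.map_comp (D.outL J h) (Equiv.refl L) (a := ⟨a', h'⟩)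
          (a' := ⟨Sum.inl ⟨a', ha.symm⟩, h'⟩) rfl x z
        rw [O.map_refl] at e1 e2
        rw [tensorComp_right R R' a D h, tensorComp_left R R' _ _ (show (D.cup J a).S (Sum.inl ⟨a', ha.symm⟩) from h'),
          tensorComp_left R R' a' D h', tensorComp_right R R' _ _ (show ¬ (D.cup L a').S (Sum.inl ⟨a, ha⟩) from h),
          tensorMap_tmk, ← e1, ← e2]
        simp only [← R.map_trans, ← R'.map_trans]
        refine tmk_congr hS _ _ _ _ ?_ ?_ _ _
        · rintro (i | j) <;> rfl
        · rintro (i | j) <;> rfl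
      · have hne : (⟨a, h⟩ : D.R) ≠ ⟨a', h'⟩ := fun k => ha (congrArg Subtype.val k)
        have e1 := R'.map_comp (D.inR J h) (Equiv.refl L) (a := Sum.inl ⟨⟨a', h'⟩, hne.symm⟩)
          (a' := ⟨Sum.inl ⟨a', ha.symm⟩, h'⟩) rfl (R'.comp ⟨a, h⟩ (smash.mk y w)) z
        have e2 := R'.map_comp (D.inR L h') (Equiv.refl J) (a := Sum.inl ⟨⟨a, h⟩, hne⟩)
          (a' := ⟨Sum.inl ⟨a, ha⟩, h⟩) rfl (R'.comp ⟨a', h'⟩ (smash.mk y z)) w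
        have e3 := R'.assoc_par hne y w z
        rw [O.map_refl] at e1 e2
        rw [tensorComp_right R R' a D h, tensorComp_right R R' _ _ (show ¬ (D.cup J a).S (Sum.inl ⟨a', ha.symm⟩) from h'),
          tensorComp_right R R' a' D h', tensorComp_right R R' _ _ (show ¬ (D.cup L a').S (Sum.inl ⟨a, ha⟩) from h),
          tensorMap_tmk, ← e1, ← e2, ← e3]
        simp only [← R.map_trans, ← R'.map_trans]
        refine tmk_congr hS _ _ _ _ ?_ ?_ _ _
        · intro i; rfl
        · rintro (⟨i | j, hj⟩ | j) <;> rfl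

/-- The components of the tensor product of two morphisms. -/
def tensorHomApp {O : PtOperad} {R₁ R₂ Q₁ Q₂ : RMod O} (f : R₁.Hom R₂) (g : Q₁.Hom Q₂)
    (K : Type) [Finite K] :
    PtMap (tensorObj R₁.toSymSeq Q₁.toSymSeq K) (tensorObj R₂.toSymSeq Q₂.toSymSeq K) :=
  wedge.desc fun D => PtMap.comp (wedge.incl D) (smash.map (f.app D.L) (g.app D.R))

theorem tensorHomApp_tmk {O : PtOperad} {R₁ R₂ Q₁ Q₂ : RMod O} (f : R₁.Hom R₂) (g : Q₁.Hom Q₂)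
    {K : Type} [Finite K] (D : Decomp K) (x : R₁.obj D.L) (y : Q₁.obj D.R) :
    tensorHomApp f g K (tmk D x y) = tmk D (f.app D.L x) (g.app D.R y) := rfl

/-- The tensor product of two morphisms of right modules. -/
def RMod.Hom.tensor {O : PtOperad} [O.LocCompact] {R₁ R₂ Q₁ Q₂ : RMod O} (f : R₁.Hom R₂)
    (g : Q₁.Hom Q₂) : (R₁.tensor Q₁).Hom (R₂.tensor Q₂) where
  app K _ _ := tensorHomApp f g K
  naturality {K K'} _ _ _ _ e x := by
    change tensorHomApp f g K' (tensorMap _ _ e x) = tensorMap _ _ e (tensorHomApp f g K x)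
    induction x using tmk_ind with
    | h0 => simp only [PtMap.map_base]
    | h D x y =>
      rw [tensorMap_tmk, tensorHomApp_tmk, tensorHomApp_tmk, tensorMap_tmk, f.naturality,
        g.naturality]
  app_comp {K J} _ _ _ _ a x z := by
    change tensorHomApp f g (Cup a J) (tensorComp R₁ Q₁ a (smash.mk x z)) =
      tensorComp R₂ Q₂ a (smash.mk (tensorHomApp f g K x) z)
    induction x using tmk_ind with
    | h0 => simp only [smash.mk_base_left, PtMap.map_base]
    | h D x y =>
      by_cases h : D.S a
      · rw [tensorComp_left _ _ a D h, tensorHomApp_tmk, tensorHomApp_tmk,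
          tensorComp_left _ _ a D h, f.naturality, g.naturality, f.app_comp]
      · rw [tensorComp_right _ _ a D h, tensorHomApp_tmk, tensorHomApp_tmk,
          tensorComp_right _ _ a D h, f.naturality, g.naturality, g.app_comp]

/-- The tensor powers of a right module: `tensorPow R m` is the power `R ⊗ ⋯ ⊗ R` with `m + 1`
factors. -/
def RMod.tensorPow {O : PtOperad} [O.LocCompact] (R : RMod O) : ℕ → RMod O
  | 0 => R
  | m + 1 => (tensorPow R m).tensor R

/-- The tensor powers of a morphism. -/
def RMod.Hom.tensorPow {O : PtOperad} [O.LocCompact] {R R' : RMod O} (f : R.Hom R') :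
    (m : ℕ) → (R.tensorPow m).Hom (R'.tensorPow m)
  | 0 => f
  | m + 1 => (tensorPow f m).tensor f

/-- A weak equivalence is `⊗`-nice if all of its tensor powers are weak equivalences. -/
def RMod.Hom.IsTensorNice {O : PtOperad} [O.LocCompact] {R R' : RMod O} (f : R.Hom R') : Prop :=
  ∀ m : ℕ, (f.tensorPow m).IsWeakEquiv

/-! ## The Fulton–MacPherson operad and its modules of configurations -/

/-- Euclidean space `ℝⁿ`. -/
abbrev E (n : ℕ) : Type := EuclideanSpace ℝ (Fin n)

/-- The space in which infinitesimal configurations are compactified: the first component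
records the directions from `x_j` to `x_i`, the second one the relative distances
`|x_i - x_j| / |x_i - x_k|` in `[0, ∞]`. The coordinates with repeated indices are constant on
configurations. -/
abbrev Screen (n : ℕ) (I : Type) : Type := (I → I → E n) × (I → I → I → ℝ≥0∞)

/-- The directions and relative distances of a configuration; they determine it up to
translation and positive scaling. -/
def screen {n : ℕ} {I : Type} (c : I → E n) : Screen n I :=
  (fun i j => ‖c i - c j‖⁻¹ • (c i - c j), fun i j k => edist (c i) (c j) / edist (c i) (c k))

/-- Restriction and relabeling of screens. -/
def Screen.pull {n : ℕ} {I I' : Type} (q : I' → I) (s : Screen n I) : Screen n I' :=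
  (fun i j => s.1 (q i) (q j), fun i j k => s.2 (q i) (q j) (q k))

/-- Grafting: replace the point labeled by `a` by an infinitesimal configuration labeled by
`J`. -/
def Screen.graft {n : ℕ} {I J : Type} (a : I) (s : Screen n I) (t : Screen n J) :
    Screen n (Cup a J) :=
  (fun p q => match p, q with
    | .inr i, .inr j => t.1 i j
    | p, q => s.1 (Cup.proj a p) (Cup.proj a q),
   fun p q r => match p, q, r with
    | .inr i, .inr j, .inr k => t.2 i j k
    | p, q, r => s.2 (Cup.proj a p) (Cup.proj a q) (Cup.proj a r))

theorem Screen.continuous_pull {n : ℕ} {I I' : Type} (q : I' → I) :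
    Continuous (Screen.pull (n := n) q) := by
  unfold Screen.pull
  fun_prop

theorem Screen.continuous_graft {n : ℕ} {I J : Type} (a : I) :
    Continuous fun p : Screen n I × Screen n J => Screen.graft a p.1 p.2 := by
  refine Continuous.prodMk ?_ ?_
  · refine continuous_pi fun p => continuous_pi fun q => ?_
    rcases p with p | p <;> rcases q with q | q <;> dsimp only <;> fun_prop
  · refine continuous_pi fun p => continuous_pi fun q => continuous_pi fun r => ?_
    rcases p with p | p <;> rcases q with q | q <;> rcases r with r | r <;> dsimp only <;> fun_prop

/-- The configuration on `I ∪_a J` in which `a` is replaced by the configuration `d`, scaled by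
`ε`. -/
def graftConf {n : ℕ} {I J : Type} (a : I) (c : I → E n) (d : J → E n) (ε : ℝ) :
    Cup a J → E n :=
  Sum.elim (fun i => c i.1) (fun j => c a + ε • d j)

theorem graftConf_tendsto {n : ℕ} {I J : Type} (a : I) (c : I → E n) (d : J → E n) (p : Cup a J) :
    Tendsto (fun ε => graftConf a c d ε p) (𝓝[>] 0) (𝓝 (c (Cup.proj a p))) := by
  rcases p with i | j
  · exact tendsto_const_nhds
  · have : Continuous fun ε : ℝ => c a + ε • d j := by fun_prop
    have h := this.tendsto 0
    simp only [zero_smul, add_zero] at h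
    exact h.mono_left nhdsWithin_le_nhds

theorem graftConf_injective {n : ℕ} {I J : Type} [Finite I] [Finite J] (a : I) {c : I → E n}
    {d : J → E n} (hc : Injective c) (hd : Injective d) :
    ∀ᶠ ε in 𝓝[>] (0 : ℝ), Injective (graftConf a c d ε) := by
  have h1 : ∀ p q : Cup a J, ∀ᶠ ε in 𝓝[>] (0 : ℝ),
      graftConf a c d ε p = graftConf a c d ε q → p = q := by
    intro p q
    by_cases h : Cup.proj a p = Cup.proj a q
    · filter_upwards [self_mem_nhdsWithin] with ε hε
      rcases p with p | p <;> rcases q with q | q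
      · exact fun _ => congrArg Sum.inl (Subtype.ext h)
      · exact absurd h p.2
      · exact absurd h.symm q.2
      · intro k
        have k' : ε • d p = ε • d q := add_left_cancel k
        exact congrArg Sum.inr (hd (smul_right_injective _ (ne_of_gt hε) k'))
    · have h3 := (graftConf_tendsto a c d p).sub (graftConf_tendsto a c d q)
      have h4 := h3.eventually_ne (sub_ne_zero.2 (hc.ne h))
      filter_upwards [h4] with ε h5 h6
      exact absurd (sub_eq_zero.2 h6) h5
  have h2 := eventually_all.2 fun p => eventually_all.2 fun q => h1 p q
  filter_upwards [h2] with ε h p q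
  exact h p q

theorem screen_graftConf_tendsto {n : ℕ} {I J : Type} (a : I) {c : I → E n}
    {d : J → E n} (hc : Injective c) :
    Tendsto (fun ε => screen (graftConf a c d ε)) (𝓝[>] 0)
      (𝓝 (Screen.graft a (screen c) (screen d))) := by
  refine Tendsto.prodMk_nhds ?_ ?_
  · refine tendsto_pi_nhds.2 fun p => tendsto_pi_nhds.2 fun q => ?_
    have gen : (Cup.proj a p ≠ Cup.proj a q ∨ p = q) →
        Tendsto (fun ε => (screen (graftConf a c d ε)).1 p q) (𝓝[>] 0)
          (𝓝 ((screen c).1 (Cup.proj a p) (Cup.proj a q))) := by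
      rintro (h | rfl)
      · have h3 := (graftConf_tendsto a c d p).sub (graftConf_tendsto a c d q)
        exact (h3.norm.inv₀ (norm_ne_zero_iff.2 (sub_ne_zero.2 (hc.ne h)))).smul h3
      · simp [screen]
    rcases p with p | p <;> rcases q with q | q
    · by_cases h : p = q
      · exact gen (Or.inr (congrArg _ h))
      · exact gen (Or.inl fun k => h (Subtype.ext k))
    · exact gen (Or.inl p.2)
    · exact gen (Or.inl q.2.symm)
    · refine tendsto_const_nhds.congr' ?_
      filter_upwards [self_mem_nhdsWithin] with ε hε
      have hε' : (0 : ℝ) < ε := hε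
      simp only [screen, graftConf, Sum.elim_inr, add_sub_add_left_eq_sub,
        ← smul_sub, norm_smul, smul_smul, Real.norm_of_nonneg hε'.le]
      congr 1
      field_simp
  · refine tendsto_pi_nhds.2 fun p => tendsto_pi_nhds.2 fun q => tendsto_pi_nhds.2 fun r => ?_
    have gen : (Cup.proj a p ≠ Cup.proj a q ∨ Cup.proj a p ≠ Cup.proj a r ∨ p = q) →
        Tendsto (fun ε => (screen (graftConf a c d ε)).2 p q r) (𝓝[>] 0)
          (𝓝 ((screen c).2 (Cup.proj a p) (Cup.proj a q) (Cup.proj a r))) := by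
      intro h
      have hpq := (graftConf_tendsto a c d p).edist (graftConf_tendsto a c d q)
      have hpr := (graftConf_tendsto a c d p).edist (graftConf_tendsto a c d r)
      rcases h with h | h | rfl
      · exact ENNReal.Tendsto.div hpq (Or.inl (edist_pos.2 (hc.ne h)).ne') hpr
          (Or.inr (edist_ne_top _ _))
      · exact ENNReal.Tendsto.div hpq (Or.inr (edist_pos.2 (hc.ne h)).ne') hpr
          (Or.inr (edist_ne_top _ _))
      · simp [screen]
    rcases p with p | p <;> rcases q with q | q <;> rcases r with r | r
    · by_cases h : p = q
      · exact gen (Or.inr (Or.inr (congrArg _ h)))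
      · exact gen (Or.inl fun k => h (Subtype.ext k))
    · exact gen (Or.inr (Or.inl p.2))
    · exact gen (Or.inl p.2)
    · exact gen (Or.inl p.2)
    · exact gen (Or.inl q.2.symm)
    · exact gen (Or.inl q.2.symm)
    · exact gen (Or.inr (Or.inl r.2.symm))
    · refine tendsto_const_nhds.congr' ?_
      filter_upwards [self_mem_nhdsWithin] with ε hε
      have hε' : (0 : ℝ) < ε := hε
      simp only [screen, graftConf, Sum.elim_inr, edist_eq_enorm_sub,
        add_sub_add_left_eq_sub, ← smul_sub, enorm_smul]
      refine (ENNReal.mul_div_mul_left _ _ ?_ ?_).symm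
      · simpa using hε'.ne'
      · simp

/-- The space `F_n(I)`: the closure of the space `Conf(ℝⁿ, I)`, taken modulo translation and
positive scaling, in the compact space of directions and relative distances. -/
def fmSet (n : ℕ) (I : Type) : Set (Screen n I) := closure (screen '' {c | Injective c})

/-- The space `F_U(I)`, for `U` open in `ℝⁿ`: the closure of `Conf(U, I)` in the product of `U^I`
and of the space of directions and relative distances. -/
def fmModSet {n : ℕ} (U : TopologicalSpace.Opens (E n)) (I : Type) :
    Set ((I → E n) × Screen n I) :=
  {z | (∀ i, z.1 i ∈ U) ∧
    z ∈ closure ((fun c => (c, screen c)) '' {c | Injective c ∧ ∀ i, c i ∈ U})}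

theorem pull_mem {n : ℕ} {I I' : Type} {q : I' → I} (hq : Injective q) {s : Screen n I}
    (hs : s ∈ fmSet n I) : s.pull q ∈ fmSet n I' := by
  refine map_mem_closure (Screen.continuous_pull q) hs ?_
  rintro _ ⟨c, hc, rfl⟩
  exact ⟨c ∘ q, Injective.comp hc hq, rfl⟩

theorem graft_mem {n : ℕ} {I J : Type} [Finite I] [Finite J] (a : I) {s : Screen n I}
    {t : Screen n J} (hs : s ∈ fmSet n I) (ht : t ∈ fmSet n J) :
    s.graft a t ∈ fmSet n (Cup a J) := by
  rw [fmSet, ← closure_closure]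
  refine map_mem_closure₂ (Screen.continuous_graft a) hs ht ?_
  rintro _ ⟨c, hc, rfl⟩ _ ⟨d, hd, rfl⟩
  refine mem_closure_of_tendsto (screen_graftConf_tendsto a hc) ?_
  filter_upwards [graftConf_injective a hc hd] with ε hε
  exact ⟨_, hε, rfl⟩

theorem pull_mem_mod {n : ℕ} {U : TopologicalSpace.Opens (E n)} {I I' : Type} {q : I' → I}
    (hq : Injective q) {z : (I → E n) × Screen n I} (hz : z ∈ fmModSet U I) :
    (z.1 ∘ q, z.2.pull q) ∈ fmModSet U I' := by
  refine ⟨fun i => hz.1 (q i), ?_⟩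
  have hcont : Continuous fun z : (I → E n) × Screen n I => (z.1 ∘ q, z.2.pull q) :=
    Continuous.prodMk (continuous_pi fun i => by dsimp only [Function.comp]; fun_prop)
      ((Screen.continuous_pull q).comp continuous_snd)
  refine map_mem_closure (f := fun z : (I → E n) × Screen n I => (z.1 ∘ q, z.2.pull q))
    hcont hz.2 ?_
  rintro _ ⟨c, hc, rfl⟩
  exact ⟨c ∘ q, ⟨Injective.comp hc.1 hq, fun i => hc.2 (q i)⟩, rfl⟩

theorem graft_mem_mod {n : ℕ} {U : TopologicalSpace.Opens (E n)} {I J : Type} [Finite I]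
    [Finite J] (a : I) {z : (I → E n) × Screen n I} {t : Screen n J} (hz : z ∈ fmModSet U I)
    (ht : t ∈ fmSet n J) : (z.1 ∘ Cup.proj a, z.2.graft a t) ∈ fmModSet U (Cup a J) := by
  refine ⟨fun p => hz.1 _, ?_⟩
  rw [← closure_closure]
  have hcont : Continuous fun p : ((I → E n) × Screen n I) × Screen n J =>
      ((p.1.1 ∘ Cup.proj a, p.1.2.graft a p.2) : (Cup a J → E n) × Screen n (Cup a J)) :=
    Continuous.prodMk (continuous_pi fun i => by dsimp only [Function.comp]; fun_prop)
      ((Screen.continuous_graft a).comp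
        ((continuous_snd.comp continuous_fst).prodMk continuous_snd))
  refine map_mem_closure₂ (f := fun (z : (I → E n) × Screen n I) (t : Screen n J) =>
    ((z.1 ∘ Cup.proj a, z.2.graft a t) : (Cup a J → E n) × Screen n (Cup a J))) hcont hz.2 ht ?_
  rintro _ ⟨c, hc, rfl⟩ _ ⟨d, hd, rfl⟩
  refine mem_closure_of_tendsto (Tendsto.prodMk_nhds
    (tendsto_pi_nhds.2 fun p => graftConf_tendsto a c d p)
    (screen_graftConf_tendsto a hc.1)) ?_
  have hU : ∀ᶠ ε in 𝓝[>] (0 : ℝ), ∀ p, graftConf a c d ε p ∈ U :=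
    eventually_all.2 fun p =>
      (graftConf_tendsto a c d p).eventually_mem (U.isOpen.mem_nhds (hc.2 _))
  filter_upwards [graftConf_injective a hc.1 hd, hU] with ε h1 h2
  exact ⟨_, ⟨h1, h2⟩, rfl⟩

theorem fmSet_diag {n : ℕ} {I : Type} {s : Screen n I} (hs : s ∈ fmSet n I) (i : I) :
    s.1 i i = 0 ∧ s.2 i i i = 0 := by
  have hc : IsClosed {s : Screen n I | s.1 i i = 0 ∧ s.2 i i i = 0} :=
    (isClosed_eq (by fun_prop) (by fun_prop)).inter (isClosed_eq (by fun_prop) (by fun_prop))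
  refine closure_minimal ?_ hc hs
  rintro _ ⟨c, -, rfl⟩
  simp [screen]

theorem fmModSet_screen_mem {n : ℕ} {U : TopologicalSpace.Opens (E n)} {I : Type}
    {z : (I → E n) × Screen n I} (hz : z ∈ fmModSet U I) : z.2 ∈ fmSet n I := by
  refine map_mem_closure continuous_snd hz.2 ?_
  rintro _ ⟨c, hc, rfl⟩
  exact ⟨c, hc.1, rfl⟩

theorem isCompact_fmSet (n : ℕ) (I : Type) : IsCompact (fmSet n I) := by
  have hK : IsCompact ((Set.univ.pi fun _ => Set.univ.pi fun _ => Metric.closedBall (0 : E n) 1) ×ˢ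
      Set.univ : Set (Screen n I)) :=
    (isCompact_univ_pi fun _ => isCompact_univ_pi fun _ => isCompact_closedBall _ _).prod
      isCompact_univ
  refine hK.of_isClosed_subset isClosed_closure (closure_minimal ?_ hK.isClosed)
  rintro _ ⟨c, -, rfl⟩
  refine ⟨fun i _ j _ => ?_, trivial⟩
  rw [mem_closedBall_zero_iff]
  simp only [screen, norm_smul, norm_inv, norm_norm]
  exact inv_mul_le_one

instance (n : ℕ) (I : Type) : CompactSpace (fmSet n I) :=
  isCompact_iff_compactSpace.1 (isCompact_fmSet n I)

/-- Relabeling in `F_n`. -/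
def fmMap {n : ℕ} {I I' : Type} (e : I ≃ I') (s : fmSet n I) : fmSet n I' :=
  ⟨s.1.pull e.symm, pull_mem e.symm.injective s.2⟩

/-- The partial composites of `F_n`. -/
def fmComp {n : ℕ} {I J : Type} [Finite I] [Finite J] (a : I) (s : fmSet n I) (t : fmSet n J) :
    fmSet n (Cup a J) := ⟨s.1.graft a t.1, graft_mem a s.2 t.2⟩

theorem continuous_fmMap {n : ℕ} {I I' : Type} (e : I ≃ I') : Continuous (fmMap (n := n) e) :=
  ((Screen.continuous_pull _).comp continuous_subtype_val).subtype_mk _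

theorem continuous_fmComp {n : ℕ} {I J : Type} [Finite I] [Finite J] (a : I) :
    Continuous fun p : fmSet n I × fmSet n J => fmComp a p.1 p.2 :=
  ((Screen.continuous_graft a).comp ((continuous_subtype_val.comp continuous_fst).prodMk
    (continuous_subtype_val.comp continuous_snd))).subtype_mk _

theorem Screen.graft_congr {n : ℕ} {I I' J J' : Type} (e : I ≃ I') (f : J ≃ J') (a : I)
    (s : Screen n I) (t : Screen n J) :
    (s.graft a t).pull (Cup.congr e f rfl).symm =
      (s.pull e.symm).graft (e a) (t.pull f.symm) := by
  refine Prod.ext ?_ ?_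
  · funext p q
    rcases p with p | p <;> rcases q with q | q <;>
      simp [Screen.pull, Screen.graft, Cup.congr, Cup.proj]
  · funext p q r
    rcases p with p | p <;> rcases q with q | q <;> rcases r with r | r <;>
      simp [Screen.pull, Screen.graft, Cup.congr, Cup.proj]

theorem Screen.graft_seq {n : ℕ} {I J L : Type} (a : I) (b : J)
    (s : Screen n I) (t : Screen n J) (u : Screen n L) :
    ((s.graft a t).graft (Sum.inr b : Cup a J) u).pull (Cup.seq L a b).symm =
      s.graft a (t.graft b u) := by
  refine Prod.ext ?_ ?_
  · funext p q
    rcases p with p | p | p <;> rcases q with q | q | q <;> rfl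
  · funext p q r
    rcases p with p | p | p <;> rcases q with q | q | q <;> rcases r with r | r | r <;> rfl

theorem Screen.graft_par {n : ℕ} {I J L : Type} {a a' : I} (h : a ≠ a')
    (s : Screen n I) (t : Screen n J) (u : Screen n L) :
    ((s.graft a t).graft (Sum.inl ⟨a', h.symm⟩ : Cup a J) u).pull (Cup.par J L h).symm =
      (s.graft a' u).graft (Sum.inl ⟨a, h⟩ : Cup a' L) t := by
  refine Prod.ext ?_ ?_
  · funext p q
    rcases p with ⟨p | p, hp⟩ | p <;> rcases q with ⟨q | q, hq⟩ | q <;> rfl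
  · funext p q r
    rcases p with ⟨p | p, hp⟩ | p <;> rcases q with ⟨q | q, hq⟩ | q <;>
      rcases r with ⟨r | r, hr⟩ | r <;> rfl

theorem continuous_prod_sum {A B C Z : Type} [TopologicalSpace A] [TopologicalSpace B]
    [TopologicalSpace C] [TopologicalSpace Z] {f : A × (B ⊕ C) → Z}
    (h1 : Continuous fun p : A × B => f (p.1, .inl p.2))
    (h2 : Continuous fun p : A × C => f (p.1, .inr p.2)) : Continuous f := by
  refine (Homeomorph.prodSumDistrib (X := A) (Y := B) (Z := C)).symm.comp_continuous_iff'.1 ?_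
  refine continuous_sum_dom.2 ⟨?_, ?_⟩
  · exact h1
  · exact h2

/-- The pointed extension of a map `X × Y → Z` to `X₊ × Y₊`. -/
def plusExt {X Y : Type} [TopologicalSpace X] [TopologicalSpace Y] {Z : PtSpace} (f : X × Y → Z) :
    plus X → plus Y → Z
  | .inl x, .inl y => f (x, y)
  | .inl _, .inr _ => Z.base
  | .inr _, _ => Z.base

theorem continuous_plusExt {X Y : Type} [TopologicalSpace X] [TopologicalSpace Y] {Z : PtSpace}
    (f : X × Y → Z) (hf : Continuous f) :
    Continuous fun p : plus X × plus Y => plusExt f p.1 p.2 := by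
  refine continuous_prod_sum (A := plus X) (B := Y) (C := Unit) ?_ ?_
  · refine (continuous_prod_sum (A := Y) (B := X) (C := Unit)
      (f := fun p => plusExt f p.2 (.inl p.1)) ?_ ?_).comp continuous_swap
    · exact hf.comp continuous_swap
    · exact continuous_const
  · refine (continuous_prod_sum (A := Unit) (B := X) (C := Unit)
      (f := fun p => plusExt f p.2 (.inr p.1)) ?_ ?_).comp continuous_swap
    · exact continuous_const
    · exact continuous_const

/-- The operad `(F_n)₊` in pointed spaces: the Fulton–MacPherson operad, with disjoint
basepoints. -/
def fmOperad (n : ℕ) : PtOperad where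
  obj I := plus (fmSet n I)
  map e := ⟨Sum.map (fmMap e) id, (continuous_fmMap e).sumMap continuous_id, rfl⟩
  map_refl I _ _ x := by rcases x with x | x <;> rfl
  map_trans e f x := by rcases x with x | x <;> rfl
  comp {I J} _ _ _ _ a := smash.desc
    (fun x y => plusExt (fun s : fmSet n I × fmSet n J =>
      (Sum.inl (fmComp a s.1 s.2) : plus (fmSet n (Cup a J)))) x y)
    (continuous_plusExt _ (continuous_inl.comp (continuous_fmComp a)))
    (fun y => by rcases y with y | y <;> rfl) (fun x => by rcases x with x | x <;> rfl)
  map_comp {I I' J J'} _ _ _ _ _ _ _ _ e f a a' h x y := by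
    subst h
    rcases x with x | x <;> rcases y with y | y
    · exact congrArg Sum.inl (Subtype.ext (Screen.graft_congr e f a x.1 y.1))
    all_goals rfl
  assoc_seq a b x y z := by
    rcases x with x | x <;> rcases y with y | y <;> rcases z with z | z
    · exact congrArg Sum.inl (Subtype.ext (Screen.graft_seq a b x.1 y.1 z.1))
    all_goals rfl
  assoc_par h x y z := by
    rcases x with x | x <;> rcases y with y | y <;> rcases z with z | z
    · exact congrArg Sum.inl (Subtype.ext (Screen.graft_par h x.1 y.1 z.1))
    all_goals rfl

instance (n : ℕ) : (fmOperad n).LocCompact where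
  out J _ _ := inferInstanceAs (LocallyCompactSpace (fmSet n J ⊕ Unit))

/-- Relabeling in `F_U`. -/
def fmModMap {n : ℕ} {U : TopologicalSpace.Opens (E n)} {I I' : Type} (e : I ≃ I')
    (z : fmModSet U I) : fmModSet U I' :=
  ⟨(z.1.1 ∘ e.symm, z.1.2.pull e.symm), pull_mem_mod e.symm.injective z.2⟩

/-- The partial composites of `F_U`. -/
def fmModComp {n : ℕ} {U : TopologicalSpace.Opens (E n)} {I J : Type} [Finite I] [Finite J]
    (a : I) (z : fmModSet U I) (t : fmSet n J) : fmModSet U (Cup a J) :=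
  ⟨(z.1.1 ∘ Cup.proj a, z.1.2.graft a t.1), graft_mem_mod a z.2 t.2⟩

theorem continuous_fmModComp {n : ℕ} {U : TopologicalSpace.Opens (E n)} {I J : Type} [Finite I]
    [Finite J] (a : I) :
    Continuous fun p : fmModSet U I × fmSet n J => fmModComp a p.1 p.2 := by
  refine Continuous.subtype_mk (Continuous.prodMk (continuous_pi fun i => ?_) ?_) _
  · dsimp only [Function.comp]; fun_prop
  · exact (Screen.continuous_graft a).comp (Continuous.prodMk
      (continuous_snd.comp (continuous_subtype_val.comp continuous_fst))
      (continuous_subtype_val.comp continuous_snd))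

/-- Restriction of infinitesimal configurations along an injection of the index sets. -/
def fmModPull {n : ℕ} {U : TopologicalSpace.Opens (E n)} {I I' : Type} {q : I' → I}
    (hq : Injective q) (z : fmModSet U I) : fmModSet U I' :=
  ⟨(z.1.1 ∘ q, z.1.2.pull q), pull_mem_mod hq z.2⟩

theorem continuous_fmModPull {n : ℕ} {U : TopologicalSpace.Opens (E n)} {I I' : Type} {q : I' → I}
    (hq : Injective q) : Continuous (fmModPull (U := U) hq) := by
  refine Continuous.subtype_mk (Continuous.prodMk (continuous_pi fun i => ?_) ?_) _
  · dsimp only [Function.comp]; fun_prop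
  · exact (Screen.continuous_pull q).comp (continuous_snd.comp continuous_subtype_val)

/-- Relabeling as a homeomorphism. -/
def fmModHomeo {n : ℕ} {U : TopologicalSpace.Opens (E n)} {I I' : Type} (e : I ≃ I') :
    fmModSet U I ≃ₜ fmModSet U I' where
  toFun := fmModMap e
  invFun := fmModMap e.symm
  left_inv z := by
    refine Subtype.ext (Prod.ext ?_ (Prod.ext ?_ ?_)) <;> funext <;>
      simp [fmModMap, Screen.pull]
  right_inv z := by
    refine Subtype.ext (Prod.ext ?_ (Prod.ext ?_ ?_)) <;> funext <;>
      simp [fmModMap, Screen.pull]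
  continuous_toFun := continuous_fmModPull e.symm.injective
  continuous_invFun := continuous_fmModPull e.symm.symm.injective

open Classical in
theorem fmModComp_retract {n : ℕ} {U : TopologicalSpace.Opens (E n)} {I J : Type} [Finite I]
    [Finite J] [Nonempty J] (a : I) : ∃ r : fmModSet U (Cup a J) → fmModSet U I,
      Continuous r ∧ ∀ z t, r (fmModComp a z t) = z := by
  let j : J := Classical.arbitrary J
  let s : I → Cup a J := fun i => if h : i = a then .inr j else .inl ⟨i, h⟩
  have hs : ∀ i, Cup.proj a (s i) = i := by
    intro i
    by_cases h : i = a
    · simp only [s, dif_pos h]; exact h.symm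
    · simp only [s, dif_neg h]; rfl
  have hs0 : s a = .inr j := dif_pos rfl
  have hs1 : ∀ i (h : i ≠ a), s i = .inl ⟨i, h⟩ := fun i h => dif_neg h
  refine ⟨fmModPull (LeftInverse.injective hs), continuous_fmModPull _, fun z t => ?_⟩
  have hz := fmSet_diag (fmModSet_screen_mem z.2) a
  have ht := fmSet_diag t.2 j
  refine Subtype.ext (Prod.ext ?_ (Prod.ext ?_ ?_))
  · funext p
    exact congrArg z.1.1 (hs p)
  · funext p q
    change (Screen.graft a z.1.2 t.1).1 (s p) (s q) = _
    by_cases hp : p = a <;> by_cases hq : q = a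
    · subst hp; subst hq; rw [hs0]; exact ht.1.trans hz.1.symm
    · subst hp; rw [hs0, hs1 q hq]; rfl
    · subst hq; rw [hs0, hs1 p hp]; rfl
    · rw [hs1 p hp, hs1 q hq]; rfl
  · funext p q r
    change (Screen.graft a z.1.2 t.1).2 (s p) (s q) (s r) = _
    by_cases hp : p = a <;> by_cases hq : q = a <;> by_cases hr : r = a
    · subst hp; subst hq; subst hr; rw [hs0]; exact ht.2.trans hz.2.symm
    · subst hp; subst hq; rw [hs0, hs1 r hr]; rfl
    · subst hp; subst hr; rw [hs0, hs1 q hq]; rfl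
    · subst hp; rw [hs0, hs1 q hq, hs1 r hr]; rfl
    · subst hq; subst hr; rw [hs0, hs1 p hp]; rfl
    · subst hq; rw [hs0, hs1 p hp, hs1 r hr]; rfl
    · subst hr; rw [hs0, hs1 p hp, hs1 q hq]; rfl
    · rw [hs1 p hp, hs1 q hq, hs1 r hr]; rfl

/-- The extension of a map `X × Y → Z` to `X⁺ × Y₊ → Z⁺`, with the remaining points sent to
infinity. -/
def onePtExt {X Y Z : Type} [TopologicalSpace X] [TopologicalSpace Y] [TopologicalSpace Z]
    (g : X → Y → Z) (u : onePt X) (v : plus Y) : onePt Z :=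
  Sum.elim (fun y => OnePoint.map (fun x => g x y) u) (fun _ => OnePoint.infty) v

theorem continuous_onePtExt {X Y Z : Type} [TopologicalSpace X] [T2Space X] [TopologicalSpace Y]
    [TopologicalSpace Z] (g : X → Y → Z) (hg : Continuous fun p : X × Y => g p.1 p.2)
    (hr : ∃ r : Z → X, Continuous r ∧ ∀ x y, r (g x y) = x) :
    Continuous fun p : onePt X × plus Y => onePtExt g p.1 p.2 := by
  obtain ⟨r, hr, hrg⟩ := hr
  refine continuous_prod_sum (A := OnePoint X) (B := Y) (C := Unit) ?_ continuous_const
  change Continuous fun p : OnePoint X × Y => OnePoint.map (fun x => g x p.2) p.1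
  rw [continuous_iff_continuousAt]
  rintro ⟨u, y⟩
  induction u using OnePoint.rec with
  | infty =>
    rw [ContinuousAt, OnePoint.map_infty, OnePoint.hasBasis_nhds_infty.tendsto_right_iff]
    rintro K ⟨-, hK⟩
    have hK' : IsCompact (r '' K) := hK.image hr
    have hN := OnePoint.hasBasis_nhds_infty.mem_of_mem (i := r '' K) ⟨hK'.isClosed, hK'⟩
    filter_upwards [prod_mem_nhds hN (univ_mem (f := 𝓝 y))]
    rintro ⟨u, y'⟩ ⟨hu, -⟩
    rcases hu with ⟨x, hx, rfl⟩ | hu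
    · exact Or.inl ⟨g x y', fun hk => hx ⟨_, hk, hrg x y'⟩, rfl⟩
    · have hu' : u = OnePoint.infty := hu
      subst hu'
      exact Or.inr rfl
  | coe x =>
    have ho : IsOpenEmbedding (Prod.map ((↑) : X → OnePoint X) (id : Y → Y)) :=
      OnePoint.isOpenEmbedding_coe.prodMap IsOpenEmbedding.id
    refine (ho.continuousAt_iff (x := (x, y))).1 ?_
    exact (OnePoint.continuous_coe.comp hg).continuousAt

/-- The right `(F_n)₊`-module `F_{U⁺}`, for `U` open in `ℝⁿ`: the levelwise one-point
compactification of `F_U`, with the extensions of the partial composites. -/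
def fmModule {n : ℕ} (U : TopologicalSpace.Opens (E n)) : RMod (fmOperad n) where
  obj I := onePt (fmModSet U I)
  map e := ⟨OnePoint.map (fmModMap e), (fmModHomeo e).onePointCongr.continuous, rfl⟩
  map_refl I _ _ x := by
    induction x using OnePoint.rec <;> rfl
  map_trans e f x := by
    induction x using OnePoint.rec <;> rfl
  comp {I J} _ _ _ _ a := smash.desc (onePtExt (Z := fmModSet U (Cup a J)) (fmModComp a))
    (continuous_onePtExt _ (continuous_fmModComp a) (fmModComp_retract a))
    (fun y => by rcases y with y | y <;> rfl) (fun x => rfl)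
  map_comp {I I' J J'} _ _ _ _ _ _ _ _ e f a a' h x y := by
    subst h
    induction x using OnePoint.rec with
    | infty => rcases y with y | y <;> rfl
    | coe x =>
      rcases y with y | y
      · refine congrArg OnePoint.some (Subtype.ext (Prod.ext ?_ ?_))
        · funext p
          rcases p with p | p
          · rfl
          · exact congrArg x.1.1 (e.symm_apply_apply a).symm
        · exact Screen.graft_congr e f a x.1.2 y.1
      · rfl
  assoc_seq a b x y z := by
    induction x using OnePoint.rec with
    | infty => rcases y with y | y <;> rcases z with z | z <;> rfl
    | coe x =>
      rcases y with y | y <;> rcases z with z | z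
      · refine congrArg OnePoint.some (Subtype.ext (Prod.ext ?_ ?_))
        · funext p
          rcases p with p | p | p <;> rfl
        · exact Screen.graft_seq a b x.1.2 y.1 z.1
      all_goals rfl
  assoc_par h x y z := by
    induction x using OnePoint.rec with
    | infty => rcases y with y | y <;> rcases z with z | z <;> rfl
    | coe x =>
      rcases y with y | y <;> rcases z with z | z
      · refine congrArg OnePoint.some (Subtype.ext (Prod.ext ?_ ?_))
        · funext p
          rcases p with ⟨p | p, hp⟩ | p <;> rfl
        · exact Screen.graft_par h x.1.2 y.1 z.1
      all_goals rfl

/-- The open unit ball `Bⁿ`. -/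
def ball (n : ℕ) : TopologicalSpace.Opens (E n) := ⟨Metric.ball 0 1, Metric.isOpen_ball⟩

/-- The one-point compactification `(Bⁿ)⁺`. -/
def ballPlus (n : ℕ) : PtSpace := onePt (ball n)

/-- The sphere `Sⁿ` in `ℝⁿ⁺¹`, based at the first basis vector. -/
def sphere (n : ℕ) : PtSpace where
  carrier := Metric.sphere (0 : E (n + 1)) 1
  base := ⟨EuclideanSpace.single 0 1, by simp⟩

/-- Pointed homeomorphisms. -/
structure PtHomeo (X Y : PtSpace) extends X ≃ₜ Y where
  map_base : toFun X.base = Y.base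

/-- The right module `Sⁿ ∧ Triv(Σ_1)` over `(F_n)₊`. -/
def sphereTriv (n : ℕ) : RMod (fmOperad n) :=
  RMod.smashLeft (sphere n) (RMod.triv (fmOperad n) (sigmaSeq 1))

/-- The only point of the configuration, for an element of `F_{Bⁿ}(1)`. -/
def onlyPoint {n : ℕ} (z : fmModSet (ball n) (Fin 1)) : ball n := ⟨z.1.1 0, z.2.1 0⟩

/-- At the one-element set, `f : F_{(Bⁿ)⁺} → Sⁿ ∧ Triv(Σ_1)` is the identification
`F_{(Bⁿ)⁺}(1) = (Bⁿ)⁺ ≅ Sⁿ = Sⁿ ∧ S⁰`, where the homeomorphism is `h`. -/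
def ExtendsIdentification {n : ℕ} (h : PtHomeo (ballPlus n) (sphere n))
    (f : (fmModule (ball n)).Hom (sphereTriv n)) : Prop :=
  ∀ z : fmModSet (ball n) (Fin 1),
    f.app (Fin 1) (OnePoint.some z) =
      smash.mk (h.toFun (OnePoint.some (onlyPoint z))) (Sum.inl (Equiv.refl (Fin 1)))

end

end FultonMacPherson

open FultonMacPherson

/-!
The map `f` is forced. Its target is a point on index sets with at least two elements, and the
identification and naturality prescribe it on one-element sets; the same triviality of the target
makes it a map of modules. What has to be shown is that it is a weak equivalence together with its
tensor powers. In fact each component of `f` is a pointed homotopy equivalence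
(`collapseApp_isHomotopyEquiv`). Wedges and smash products preserve pointed homotopies without any
assumption on the basepoints, because homotopies `X × [0, 1] → Y` are pointed maps from `X` to the
path space of `Y`; so the components of the tensor powers are pointed homotopy equivalences too
(`RMod.Hom.tensorPow_isHomotopyEquiv`). A homotopy equivalence is a weak equivalence at all
basepoints (`isWeakEquiv_of_homotopic`); as a free homotopy moves the basepoint, this uses the
change of basepoint along a path, which is made explicit by adding a collar to the cube.

On one-element sets `f` is a homeomorphism. For `|I| ≥ 2` the claim is that `F_{Bⁿ}(I)⁺` contracts
to its basepoint. Fix `i₀` in `I`. A screen `s` has a continuous macroscopic shape `d(s)`, the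
configuration with `d_{i₀} = 0` and `∑ |d_i| = 1`, in which points may coincide but not all of them
do. The space `F_{Bⁿ}(I)` consists of the pairs `(x, s)` with `x_i = y + r d_i(s)` in `Bⁿ` for some
position `y` and size `r ≥ 0` (`position_eq` and `mem_fmModSet_of_shape`). Increasing `r` expands
every configuration, also the infinitesimal ones with `r = 0`, until it leaves the ball, that is,
until it reaches the point at infinity. Convexity of the ball makes the partially defined expansion
proper (`isCompact_expand_preimage`), hence continuous on the one-point compactification, and
boundedness makes a finite time sufficient (`fmModule_homotopic_const`).
-/

namespace FultonMacPherson

open Set Filter Topology Function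
open scoped ENNReal

noncomputable section

/-! ### Pointed homotopies -/

/-- The space of free paths in `Y`, based at the constant path. A pointed homotopy of maps
`X → Y` is a pointed map from `X` to this space, so that homotopies out of wedges and smash
products are given by the universal properties of these. -/
def pathSpace (Y : PtSpace) : PtSpace where
  carrier := C(unitInterval, Y)
  base := ContinuousMap.const _ Y.base

/-- The pointed map to the path space that corresponds to a homotopy `F`. -/
def pathSpace.lift {X Y : PtSpace} (F : X → unitInterval → Y)
    (hF : Continuous fun p : X × unitInterval => F p.1 p.2) (h0 : ∀ t, F X.base t = Y.base) :
    PtMap X (pathSpace Y) where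
  toFun x := (⟨F x, hF.comp (Continuous.prodMk_right x)⟩ : C(unitInterval, Y))
  cont := (ContinuousMap.curry ⟨fun p : X × unitInterval => F p.1 p.2, hF⟩).continuous
  map_base' := ContinuousMap.ext h0

/-- The value at time `t` of a path. -/
def pathSpace.eval {Y : PtSpace} (γ : pathSpace Y) (t : unitInterval) : Y :=
  (show C(unitInterval, Y) from γ) t

theorem pathSpace.continuous_eval {X Y : PtSpace} (H : PtMap X (pathSpace Y)) :
    Continuous fun p : X × unitInterval => pathSpace.eval (H p.1) p.2 :=
  (ContinuousEval.continuous_eval (F := C(unitInterval, Y))).comp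
    ((H.continuous.comp continuous_fst).prodMk continuous_snd)

theorem pathSpace.eval_base {X Y : PtSpace} (H : PtMap X (pathSpace Y)) (t : unitInterval) :
    pathSpace.eval (H X.base) t = Y.base := by
  rw [H.map_base]
  rfl

/-- The identity of a pointed space. -/
def PtMap.id (X : PtSpace) : PtMap X X := ⟨fun x => x, continuous_id, rfl⟩

/-- Pointed homotopy of pointed maps. -/
def PtMap.Homotopic {X Y : PtSpace} (f g : PtMap X Y) : Prop :=
  ∃ H : PtMap X (pathSpace Y),
    ∀ x, pathSpace.eval (H x) 0 = f x ∧ pathSpace.eval (H x) 1 = g x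

theorem PtMap.Homotopic.refl {X Y : PtSpace} (f : PtMap X Y) : f.Homotopic f :=
  ⟨pathSpace.lift (fun x _ => f x) (f.continuous.comp continuous_fst) fun _ => f.map_base,
    fun _ => ⟨rfl, rfl⟩⟩

theorem PtMap.Homotopic.symm {X Y : PtSpace} {f g : PtMap X Y} (h : f.Homotopic g) :
    g.Homotopic f := by
  obtain ⟨H, hH⟩ := h
  refine ⟨pathSpace.lift (fun x t => pathSpace.eval (H x) (unitInterval.symm t))
    ((pathSpace.continuous_eval H).comp (continuous_fst.prodMk
      (unitInterval.continuous_symm.comp continuous_snd))) fun t => pathSpace.eval_base H _,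
    fun x => ⟨?_, ?_⟩⟩
  · change pathSpace.eval (H x) (unitInterval.symm 0) = g x
    rw [unitInterval.symm_zero]
    exact (hH x).2
  · change pathSpace.eval (H x) (unitInterval.symm 1) = f x
    rw [unitInterval.symm_one]
    exact (hH x).1

theorem PtMap.Homotopic.comp_left {X Y Z : PtSpace} (k : PtMap Y Z) {f g : PtMap X Y}
    (h : f.Homotopic g) : (k.comp f).Homotopic (k.comp g) := by
  obtain ⟨H, hH⟩ := h
  refine ⟨pathSpace.lift (fun x t => k (pathSpace.eval (H x) t))
    (k.continuous.comp (pathSpace.continuous_eval H)) fun t => ?_, fun x => ?_⟩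
  · rw [pathSpace.eval_base, k.map_base]
  · exact ⟨congrArg k (hH x).1, congrArg k (hH x).2⟩

theorem smash.map_homotopic {X X' Y Y' : PtSpace} {f f' : PtMap X X'} {g g' : PtMap Y Y'}
    (hf : f.Homotopic f') (hg : g.Homotopic g') :
    (smash.map f g).Homotopic (smash.map f' g') := by
  obtain ⟨F, hF⟩ := hf
  obtain ⟨G, hG⟩ := hg
  have hcont : Continuous fun p : (X × Y) × unitInterval =>
      (smash.mk (pathSpace.eval (F p.1.1) p.2) (pathSpace.eval (G p.1.2) p.2) :
        smash X' Y') :=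
    smash.continuous_mk.comp
      (((pathSpace.continuous_eval F).comp
        ((continuous_fst.comp continuous_fst).prodMk continuous_snd)).prodMk
      ((pathSpace.continuous_eval G).comp
        ((continuous_snd.comp continuous_fst).prodMk continuous_snd)))
  refine ⟨smash.desc (Z := pathSpace (smash X' Y'))
    (fun x y => (⟨fun t => smash.mk (pathSpace.eval (F x) t) (pathSpace.eval (G y) t),
      hcont.comp (Continuous.prodMk_right (x, y))⟩ : C(unitInterval, smash X' Y')))
    (ContinuousMap.curry ⟨_, hcont⟩).continuous (fun y => ?_) (fun x => ?_), fun z => ?_⟩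
  · refine ContinuousMap.ext fun t => ?_
    change smash.mk (pathSpace.eval (F X.base) t) _ = (smash X' Y').base
    rw [pathSpace.eval_base, smash.mk_base_left]
  · refine ContinuousMap.ext fun t => ?_
    change smash.mk _ (pathSpace.eval (G Y.base) t) = (smash X' Y').base
    rw [pathSpace.eval_base, smash.mk_base_right]
  · induction z using smash.ind with
    | h x y =>
      exact ⟨congrArg₂ smash.mk (hF x).1 (hG y).1, congrArg₂ smash.mk (hF x).2 (hG y).2⟩

theorem wedge.desc_homotopic {ι : Type} {X : ι → PtSpace} {Z : PtSpace}
    {f g : ∀ i, PtMap (X i) Z} (h : ∀ i, (f i).Homotopic (g i)) :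
    (wedge.desc f).Homotopic (wedge.desc g) := by
  choose H hH using h
  refine ⟨wedge.desc H, fun z => ?_⟩
  induction z using wedge.ind with
  | h0 => exact ⟨rfl, rfl⟩
  | h i x => exact hH i x

/-- Pointed homotopy equivalences. -/
def PtMap.IsHomotopyEquiv {X Y : PtSpace} (f : PtMap X Y) : Prop :=
  ∃ g : PtMap Y X, (g.comp f).Homotopic (PtMap.id X) ∧ (f.comp g).Homotopic (PtMap.id Y)

theorem smash.map_isHomotopyEquiv {X X' Y Y' : PtSpace} {f : PtMap X X'} {g : PtMap Y Y'}
    (hf : f.IsHomotopyEquiv) (hg : g.IsHomotopyEquiv) :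
    (smash.map f g).IsHomotopyEquiv := by
  obtain ⟨f', hf1, hf2⟩ := hf
  obtain ⟨g', hg1, hg2⟩ := hg
  have hid : ∀ A B : PtSpace, smash.map (PtMap.id A) (PtMap.id B) = PtMap.id (smash A B) :=
    fun A B => PtMap.ext fun z => by
      induction z using smash.ind with
      | h x y => rfl
  have hcomp : ∀ {A A' A'' B B' B'' : PtSpace} (a : PtMap A A') (a' : PtMap A' A'')
      (b : PtMap B B') (b' : PtMap B' B''), (smash.map a' b').comp (smash.map a b) =
        smash.map (a'.comp a) (b'.comp b) :=
    fun a a' b b' => PtMap.ext fun z => by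
      induction z using smash.ind with
      | h x y => rfl
  refine ⟨smash.map f' g', ?_, ?_⟩
  · rw [hcomp, ← hid]
    exact smash.map_homotopic hf1 hg1
  · rw [hcomp, ← hid]
    exact smash.map_homotopic hf2 hg2

theorem wedge.map_isHomotopyEquiv {ι : Type} {X Y : ι → PtSpace} {f : ∀ i, PtMap (X i) (Y i)}
    (hf : ∀ i, (f i).IsHomotopyEquiv) :
    (wedge.desc fun i => (wedge.incl (X := Y) i).comp (f i)).IsHomotopyEquiv := by
  choose g hg1 hg2 using hf
  have hid : ∀ A : ι → PtSpace,
      (wedge.desc fun i => (wedge.incl (X := A) i).comp (PtMap.id (A i))) = PtMap.id (wedge A) :=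
    fun A => PtMap.ext fun z => by
      induction z using wedge.ind with
      | h0 => rfl
      | h i x => rfl
  have hcomp : ∀ {A B C : ι → PtSpace} (a : ∀ i, PtMap (A i) (B i)) (b : ∀ i, PtMap (B i) (C i)),
      (wedge.desc fun i => (wedge.incl (X := C) i).comp (b i)).comp
        (wedge.desc fun i => (wedge.incl (X := B) i).comp (a i)) =
      wedge.desc fun i => (wedge.incl (X := C) i).comp ((b i).comp (a i)) :=
    fun a b => PtMap.ext fun z => by
      induction z using wedge.ind with
      | h0 => rfl
      | h i x => rfl
  refine ⟨wedge.desc fun i => (wedge.incl (X := X) i).comp (g i), ?_, ?_⟩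
  · rw [hcomp, ← hid]
    exact wedge.desc_homotopic fun i => (hg1 i).comp_left _
  · rw [hcomp, ← hid]
    exact wedge.desc_homotopic fun i => (hg2 i).comp_left _

/-- A levelwise pointed homotopy equivalence has levelwise pointed homotopy equivalences as
tensor powers; the levelwise inverses need not be maps of modules for this. -/
theorem RMod.Hom.tensorPow_isHomotopyEquiv {O : PtOperad} [O.LocCompact] {R R' : RMod O}
    (f : R.Hom R') (hf : ∀ (I : Type) [Finite I] [Nonempty I], (f.app I).IsHomotopyEquiv)
    (m : ℕ) (I : Type) [Finite I] [Nonempty I] : ((f.tensorPow m).app I).IsHomotopyEquiv := by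
  induction m generalizing I with
  | zero => exact hf I
  | succ m ih =>
    exact wedge.map_isHomotopyEquiv fun D : Decomp I =>
      smash.map_isHomotopyEquiv (ih D.L) (hf D.R)

theorem PtMap.Homotopic.toContinuousMap {X Y : PtSpace} {f g : PtMap X Y} (h : f.Homotopic g) :
    f.toContinuousMap.Homotopic g.toContinuousMap := by
  obtain ⟨H, hH⟩ := h
  exact ⟨{
    toFun := fun p => pathSpace.eval (H p.2) p.1
    continuous_toFun := (pathSpace.continuous_eval H).comp continuous_swap
    map_zero_left := fun x => (hH x).1
    map_one_left := fun x => (hH x).2 }⟩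

/-! ### Homotopy equivalences are weak homotopy equivalences -/

/-- The distance from the centre in the cube `I^n`, normalised to be `1` on the boundary. For
`n = 0` it is zero and the boundary is empty. -/
def cubeNorm {n : ℕ} (y : Fin n → unitInterval) : ℝ := ‖fun i => 2 * (y i : ℝ) - 1‖

/-- The dilation of the cube by the factor `c` about its centre, followed by the retraction of
the result onto the cube. -/
def cubeDilate {n : ℕ} (c : ℝ) (y : Fin n → unitInterval) : Fin n → unitInterval :=
  fun i => projIcc 0 1 zero_le_one (1 / 2 + c * ((y i : ℝ) - 1 / 2))

theorem continuous_cubeNorm {n : ℕ} : Continuous (cubeNorm (n := n)) := by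
  unfold cubeNorm
  fun_prop

theorem continuous_cubeDilate {n : ℕ} :
    Continuous fun p : ℝ × (Fin n → unitInterval) => cubeDilate p.1 p.2 := by
  unfold cubeDilate
  refine continuous_pi fun i => continuous_projIcc.comp ?_
  fun_prop

theorem cubeDilate_one {n : ℕ} (y : Fin n → unitInterval) : cubeDilate 1 y = y := by
  funext i
  have : (1 / 2 + 1 * ((y i : ℝ) - 1 / 2)) = y i := by ring
  simp only [cubeDilate, this, projIcc_val]

theorem cubeNorm_boundary {n : ℕ} {y : Fin n → unitInterval} (hy : y ∈ Cube.boundary (Fin n)) :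
    cubeNorm y = 1 := by
  obtain ⟨i, hi⟩ := hy
  refine le_antisymm ((pi_norm_le_iff_of_nonneg zero_le_one).2 fun j => ?_) ?_
  · rw [Real.norm_eq_abs, abs_le]
    have h0 := (y j).2.1
    have h1 := (y j).2.2
    constructor <;> linarith
  · refine le_trans (le_of_eq ?_) (norm_le_pi_norm (fun i => 2 * (y i : ℝ) - 1) i)
    rcases hi with hi | hi <;> simp [hi]
    norm_num

theorem cubeDilate_mem_boundary {n : ℕ} {c : ℝ} {y : Fin n → unitInterval} (hc : 0 ≤ c)
    (h : 1 ≤ c * cubeNorm y) : cubeDilate c y ∈ Cube.boundary (Fin n) := by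
  by_contra hb
  have hlt : ∀ i, ‖c * (2 * (y i : ℝ) - 1)‖ < 1 := by
    intro i
    by_contra hi
    refine hb ⟨i, ?_⟩
    rw [Real.norm_eq_abs, not_lt, le_abs] at hi
    rcases hi with hi | hi
    · exact Or.inr (projIcc_of_right_le _ (by linarith))
    · exact Or.inl (projIcc_of_le_left _ (by linarith))
  have : ‖c • (fun i => 2 * (y i : ℝ) - 1)‖ < 1 := (pi_norm_lt_iff zero_lt_one).2 hlt
  rw [norm_smul, Real.norm_of_nonneg hc] at this
  exact absurd h (not_le.2 this)

open Classical in
/-- The cube shrunk by the factor `c`, mapped by `p`, and surrounded by a collar that is mapped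
radially along `γ`, starting from time `a` and at unit speed. -/
def collar {X : Type} {n : ℕ} (γ : unitInterval → X) (a : unitInterval) (c : ℝ)
    (p : (Fin n → unitInterval) → X) (y : Fin n → unitInterval) : X :=
  if c * cubeNorm y ≤ 1 then p (cubeDilate c y)
  else γ (projIcc 0 1 zero_le_one (a + (c * cubeNorm y - 1)))

theorem continuous_collar {A X : Type} [TopologicalSpace A] [TopologicalSpace X] {n : ℕ}
    {γ : unitInterval → X} (hγ : Continuous γ) {a : A → unitInterval} (ha : Continuous a)
    {c : A → ℝ} (hc : Continuous c) (hc0 : ∀ s, 0 ≤ c s) {p : A → (Fin n → unitInterval) → X}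
    (hp : Continuous fun q : A × (Fin n → unitInterval) => p q.1 q.2)
    (hb : ∀ s, ∀ y ∈ Cube.boundary (Fin n), p s y = γ (a s)) :
    Continuous fun q : A × (Fin n → unitInterval) => collar γ (a q.1) (c q.1) (p q.1) q.2 := by
  unfold collar
  have hn := continuous_cubeNorm (n := n)
  refine Continuous.if_le ?_ ?_ (by fun_prop) continuous_const ?_
  · exact hp.comp (continuous_fst.prodMk
      (continuous_cubeDilate.comp ((hc.comp continuous_fst).prodMk continuous_snd)))
  · exact hγ.comp (continuous_projIcc.comp (by fun_prop))
  · rintro ⟨s, y⟩ h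
    rw [hb s _ (cubeDilate_mem_boundary (hc0 s) h.ge)]
    dsimp only at h ⊢
    rw [h, sub_self, add_zero, projIcc_val]

theorem collar_one {X : Type} {n : ℕ} {γ : unitInterval → X} {a : unitInterval}
    {p : (Fin n → unitInterval) → X} (y : Fin n → unitInterval) : collar γ a 1 p y = p y := by
  have h : cubeNorm y ≤ 1 := (pi_norm_le_iff_of_nonneg zero_le_one).2 fun j => by
    rw [Real.norm_eq_abs, abs_le]
    have h0 := (y j).2.1
    have h1 := (y j).2.2
    constructor <;> linarith
  rw [collar, one_mul, if_pos h, cubeDilate_one]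

theorem collar_boundary {X : Type} {n : ℕ} {γ : unitInterval → X} {a : unitInterval} {c : ℝ}
    (hc : 1 ≤ c) {p : (Fin n → unitInterval) → X}
    (hb : ∀ y ∈ Cube.boundary (Fin n), p y = γ a) {y : Fin n → unitInterval}
    (hy : y ∈ Cube.boundary (Fin n)) :
    collar γ a c p y = γ (projIcc 0 1 zero_le_one (a + (c - 1))) := by
  rw [collar, cubeNorm_boundary hy, mul_one]
  split_ifs with h
  · obtain rfl : c = 1 := le_antisymm h hc
    rw [cubeDilate_one, hb y hy, sub_self, add_zero, projIcc_val]
  · rfl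

/-- Homotopy of maps on the cube, through maps that are constantly equal to `γ t` on the boundary
at time `t`. -/
def HomotopicAlong {X : Type} [TopologicalSpace X] {n : ℕ} (γ : unitInterval → X)
    (p q : (Fin n → unitInterval) → X) : Prop :=
  ∃ F : unitInterval → (Fin n → unitInterval) → X,
    (Continuous fun r : unitInterval × (Fin n → unitInterval) => F r.1 r.2) ∧
    (∀ y, F 0 y = p y) ∧ (∀ y, F 1 y = q y) ∧ ∀ t, ∀ y ∈ Cube.boundary (Fin n), F t y = γ t

theorem HomotopicAlong.symm {X : Type} [TopologicalSpace X] {n : ℕ} {x x' : X} {γ : Path x x'}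
    {p q : (Fin n → unitInterval) → X} (h : HomotopicAlong γ p q) :
    HomotopicAlong γ.symm q p := by
  obtain ⟨F, hF, h0, h1, hb⟩ := h
  refine ⟨fun t => F (unitInterval.symm t), ?_, ?_, ?_, fun t => hb _⟩
  · exact hF.comp ((unitInterval.continuous_symm.comp continuous_fst).prodMk continuous_snd)
  · simpa using h1
  · simpa using h0

theorem GenLoop.eq_source {X : Type} [TopologicalSpace X] {n : ℕ} {x x' : X} (γ : Path x x')
    (p : GenLoop (Fin n) X x) (y : Fin n → unitInterval) (hy : y ∈ Cube.boundary (Fin n)) :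
    p.1 y = γ 0 :=
  (p.2 y hy).trans γ.source.symm

theorem collar_zero_two_boundary {X : Type} [TopologicalSpace X] {n : ℕ} {x x' : X}
    (γ : Path x x') {p : (Fin n → unitInterval) → X}
    (hb : ∀ y ∈ Cube.boundary (Fin n), p y = γ 0) {y : Fin n → unitInterval}
    (hy : y ∈ Cube.boundary (Fin n)) : collar γ 0 2 p y = x' := by
  rw [collar_boundary one_le_two hb hy, projIcc_of_right_le _ (by norm_num)]
  exact γ.target

theorem continuous_collar_zero_two {X : Type} [TopologicalSpace X] {n : ℕ} {x x' : X}
    (γ : Path x x') (p : GenLoop (Fin n) X x) : Continuous (collar γ 0 2 p.1) := by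
  have h : Continuous fun q : Unit × (Fin n → unitInterval) => collar γ 0 2 p.1 q.2 :=
    continuous_collar (A := Unit) (γ := γ) γ.continuous (a := fun _ => 0)
      continuous_const (c := fun _ => 2) continuous_const (fun _ => zero_le_two)
      (p := fun _ => p.1) (p.1.continuous.comp continuous_snd) (fun _ => GenLoop.eq_source γ p)
  have h' := h.comp (Continuous.prodMk_right (X := Unit) ())
  simpa only [Function.comp_def] using h'

/-- The transport of a generalized loop along a path of basepoints. -/
def transport {X : Type} [TopologicalSpace X] {n : ℕ} {x x' : X} (γ : Path x x')
    (p : GenLoop (Fin n) X x) : GenLoop (Fin n) X x' :=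
  ⟨⟨collar γ 0 2 p.1, continuous_collar_zero_two γ p⟩,
    fun _ hy => collar_zero_two_boundary γ (GenLoop.eq_source γ p) hy⟩

theorem homotopicAlong_transport {X : Type} [TopologicalSpace X] {n : ℕ} {x x' : X}
    (γ : Path x x') (p : GenLoop (Fin n) X x) : HomotopicAlong γ p (transport γ p) := by
  have hb := GenLoop.eq_source γ p
  refine ⟨fun s => collar γ 0 (1 + s) p.1, ?_, ?_, ?_, ?_⟩
  · exact continuous_collar (a := fun _ : unitInterval => 0) (c := fun s => 1 + s)
      (p := fun _ => p.1) γ.continuous continuous_const (by fun_prop)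
      (fun s => add_nonneg zero_le_one s.2.1) (p.1.continuous.comp continuous_snd)
      (fun _ => hb)
  · intro y
    simp only [Icc.coe_zero, add_zero, collar_one]
    rfl
  · intro y
    dsimp only
    rw [Icc.coe_one, one_add_one_eq_two]
    rfl
  · intro t y hy
    have h := collar_boundary (γ := γ) (a := 0) (c := 1 + t) (le_add_of_nonneg_right t.2.1) hb hy
    rw [Icc.coe_zero] at h
    rw [zero_add, add_sub_cancel_left, projIcc_val] at h
    exact h

/-- Surrounding `F t` by a collar along the remaining part of the path turns a homotopy `F` along
`γ` into one relative to the boundary, which starts from the transport. -/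
theorem HomotopicAlong.transport_homotopic {X : Type} [TopologicalSpace X] {n : ℕ} {x x' : X}
    {γ : Path x x'} {p : GenLoop (Fin n) X x} {q : GenLoop (Fin n) X x'}
    (h : HomotopicAlong γ p q) : GenLoop.Homotopic (transport γ p) q := by
  obtain ⟨F, hF, h0, h1, hb⟩ := h
  have h0' : F 0 = p := funext h0
  have hcont := continuous_collar (a := fun t : unitInterval => t) (c := fun t => 2 - t)
      (p := F) γ.continuous continuous_id (by fun_prop)
      (fun s => by linarith [s.2.2]) hF hb
  refine ⟨{
    toFun := fun r => collar γ r.1 (2 - r.1) (F r.1) r.2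
    continuous_toFun := hcont
    map_zero_left := fun y => ?_
    map_one_left := fun y => ?_
    prop' := fun t y hy => ?_ }⟩
  · dsimp only
    rw [Icc.coe_zero, sub_zero, h0']
    rfl
  · dsimp only
    rw [Icc.coe_one, show (2 : ℝ) - 1 = 1 by norm_num, collar_one, h1]
    rfl
  · refine (collar_boundary (by linarith [t.2.2]) (hb t) hy).trans ?_
    rw [projIcc_of_right_le _ (by linarith)]
    exact γ.target.trans ((transport γ p).2 y hy).symm

theorem transport_congr {X : Type} [TopologicalSpace X] {n : ℕ} {x x' : X} (γ : Path x x')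
    {p q : GenLoop (Fin n) X x} (h : GenLoop.Homotopic p q) :
    GenLoop.Homotopic (transport γ p) (transport γ q) := by
  obtain ⟨F⟩ := h
  have hb : ∀ t, ∀ y ∈ Cube.boundary (Fin n), F (t, y) = γ 0 := fun t y hy => by
    rw [γ.source]
    exact (F.eq_fst t hy).trans (p.2 y hy)
  have hcont := continuous_collar (a := fun _ : unitInterval => 0) (c := fun _ => 2)
      (p := fun t y => F (t, y)) γ.continuous continuous_const continuous_const
      (fun _ => zero_le_two) F.continuous hb
  refine ⟨{
    toFun := fun r => collar γ 0 2 (fun y => F (r.1, y)) r.2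
    continuous_toFun := hcont
    map_zero_left := fun y => ?_
    map_one_left := fun y => ?_
    prop' := fun t y hy => ?_ }⟩
  · simp only [F.apply_zero]
    rfl
  · simp only [F.apply_one]
    rfl
  · exact (collar_zero_two_boundary γ (hb t) hy).trans ((transport γ p).2 y hy).symm

/-- The change of basepoint map along a path. -/
def transportMap {X : Type} [TopologicalSpace X] (n : ℕ) {x x' : X} (γ : Path x x') :
    HomotopyGroup (Fin n) X x → HomotopyGroup (Fin n) X x' :=
  Quotient.map' (transport γ) fun _ _ => transport_congr γ

theorem transportMap_symm_transportMap {X : Type} [TopologicalSpace X] (n : ℕ) {x x' : X}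
    (γ : Path x x') (a : HomotopyGroup (Fin n) X x) :
    transportMap n γ.symm (transportMap n γ a) = a := by
  induction a using Quotient.inductionOn' with
  | h p => exact Quotient.sound' (homotopicAlong_transport γ p).symm.transport_homotopic

theorem transportMap_bijective {X : Type} [TopologicalSpace X] (n : ℕ) {x x' : X}
    (γ : Path x x') : Bijective (transportMap n γ) := by
  refine bijective_iff_has_inverse.2 ⟨transportMap n γ.symm, transportMap_symm_transportMap n γ,
    fun a => ?_⟩
  have := transportMap_symm_transportMap n γ.symm a
  rwa [γ.symm_symm] at this

/-- The trace of a loop under a homotopy from `h` to the identity is a homotopy along the track of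
the basepoint, so that `h` induces the inverse of a change of basepoint map. -/
theorem homotopyGroupMap_bijective_of_homotopic_id {X : Type} [TopologicalSpace X] {h : C(X, X)}
    (H : h.Homotopic (ContinuousMap.id X)) (n : ℕ) (x : X) :
    Bijective (homotopyGroupMap h n x) := by
  obtain ⟨H⟩ : Nonempty (h.Homotopy (ContinuousMap.id X)) := H
  have key : ∀ a, transportMap n (H.evalAt x) (homotopyGroupMap h n x a) = a := by
    intro a
    induction a using Quotient.inductionOn' with
    | h p =>
      refine Quotient.sound' (HomotopicAlong.transport_homotopic ?_)
      refine ⟨fun t y => H (t, p y), ?_, fun y => H.apply_zero _, fun y => H.apply_one _,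
        fun t y hy => ?_⟩
      · exact H.continuous.comp (continuous_fst.prodMk (p.1.continuous.comp continuous_snd))
      · exact congrArg (fun z => H (t, z)) (p.2 y hy)
  have hb := transportMap_bijective n (H.evalAt x)
  refine (Bijective.of_comp_iff' hb _).1 ?_
  rw [show transportMap n (H.evalAt x) ∘ homotopyGroupMap h n x = id from funext key]
  exact bijective_id

theorem homotopyGroupMap_comp {X Y Z : Type} [TopologicalSpace X] [TopologicalSpace Y]
    [TopologicalSpace Z] (g : C(Y, Z)) (f : C(X, Y)) (n : ℕ) (x : X) :
    homotopyGroupMap (g.comp f) n x = homotopyGroupMap g n (f x) ∘ homotopyGroupMap f n x := by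
  funext a
  induction a using Quotient.inductionOn' with
  | h p => rfl

theorem isWeakEquiv_of_homotopic {X Y : Type} [TopologicalSpace X] [TopologicalSpace Y]
    {f : C(X, Y)} {g : C(Y, X)} (hgf : (g.comp f).Homotopic (ContinuousMap.id X))
    (hfg : (f.comp g).Homotopic (ContinuousMap.id Y)) : IsWeakEquiv f := by
  refine ⟨bijective_iff_has_inverse.2 ⟨zerothHomotopyMap g, ?_, ?_⟩, fun n x => ?_⟩
  · obtain ⟨H⟩ := hgf
    intro a
    induction a using Quotient.inductionOn' with
    | h x => exact Quotient.sound' ⟨H.evalAt x⟩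
  · obtain ⟨H⟩ := hfg
    intro a
    induction a using Quotient.inductionOn' with
    | h x => exact Quotient.sound' ⟨H.evalAt x⟩
  · have h1 := homotopyGroupMap_bijective_of_homotopic_id hgf n x
    have h2 := homotopyGroupMap_bijective_of_homotopic_id hfg n (f x)
    rw [homotopyGroupMap_comp] at h1 h2
    -- two out of six for `π_n(f)`, `π_n(g)`, `π_n(f)` at the basepoints `x`, `f x`, `g (f x)`
    have hg : Bijective (homotopyGroupMap g n (f x)) := ⟨h2.1.of_comp, h1.2.of_comp⟩
    exact (Bijective.of_comp_iff' hg _).1 h1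

theorem PtMap.IsHomotopyEquiv.isWeakEquiv {X Y : PtSpace} {f : PtMap X Y}
    (hf : f.IsHomotopyEquiv) : IsWeakEquiv f.toContinuousMap := by
  obtain ⟨g, hgf, hfg⟩ := hf
  exact isWeakEquiv_of_homotopic (g := g.toContinuousMap) hgf.toContinuousMap
    hfg.toContinuousMap

/-! ### The macroscopic shape of an infinitesimal configuration -/

/-- The point labelled by `i` of the configuration with screen `s`, when the latter is normalised
so that the point `i₀` is at the origin and the distances of the points from the origin add up to
`1`. It is the direction from `i₀` to `i`, times the reciprocal of the sum over `k` of the relative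
distances `|x_{i₀} - x_k| / |x_{i₀} - x_i|`; an infinite sum gives the origin, and so does `i = i₀`,
where the direction is zero. -/
def Screen.shape {n : ℕ} {ι : Type} [Fintype ι] (i₀ : ι) (s : Screen n ι) (i : ι) : E n :=
  ((∑ k, s.2 i₀ k i)⁻¹).toReal • s.1 i i₀

theorem shape_screen {n : ℕ} {ι : Type} [Fintype ι] (i₀ : ι) {c : ι → E n} (hc : Injective c)
    (i : ι) : (screen c).shape i₀ i = (∑ k, dist (c i₀) (c k))⁻¹ • (c i - c i₀) := by
  rcases eq_or_ne i i₀ with rfl | hi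
  · simp [Screen.shape, screen]
  · have h0 : ‖c i - c i₀‖ ≠ 0 := norm_ne_zero_iff.2 (sub_ne_zero.2 (hc.ne hi))
    have hsum : ∑ k, (screen c).2 i₀ k i = (∑ k, edist (c i₀) (c k)) / edist (c i₀) (c i) := by
      simp only [screen, div_eq_mul_inv, Finset.sum_mul]
    have hreal : (∑ k, edist (c i₀) (c k)).toReal = ∑ k, dist (c i₀) (c k) := by
      rw [ENNReal.toReal_sum fun k _ => edist_ne_top _ _]
      simp only [← dist_edist]
    rw [Screen.shape, hsum, ENNReal.toReal_inv, ENNReal.toReal_div, hreal, ← dist_edist,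
      dist_comm (c i₀) (c i), dist_eq_norm (c i), inv_div]
    simp only [screen, smul_smul]
    congr 1
    field_simp

theorem fmSet_rel_self {n : ℕ} {ι : Type} {s : Screen n ι} (hs : s ∈ fmSet n ι) {i j : ι}
    (h : i ≠ j) : s.2 i j j = 1 := by
  have hc : IsClosed {s : Screen n ι | s.2 i j j = 1} := isClosed_eq (by fun_prop) (by fun_prop)
  refine closure_minimal ?_ hc hs
  rintro _ ⟨c, hc, rfl⟩
  exact ENNReal.div_self (edist_pos.2 (hc.ne h)).ne' (edist_ne_top _ _)

theorem shape_base {n : ℕ} {ι : Type} [Fintype ι] (i₀ : ι) {s : Screen n ι}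
    (hs : s ∈ fmSet n ι) : s.shape i₀ i₀ = 0 := by
  rw [Screen.shape, (fmSet_diag hs i₀).1, smul_zero]

theorem continuousOn_shape {n : ℕ} {ι : Type} [Fintype ι] (i₀ : ι) :
    ContinuousOn (fun s : Screen n ι => s.shape i₀) (fmSet n ι) := by
  refine continuousOn_pi.2 fun i => ?_
  rcases eq_or_ne i i₀ with rfl | hi
  · exact continuousOn_const.congr fun s hs => shape_base i hs
  · intro s hs
    have h1 : (1 : ℝ≥0∞) ≤ ∑ k, s.2 i₀ k i := by
      rw [← fmSet_rel_self hs hi.symm]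
      exact Finset.single_le_sum (f := fun k => s.2 i₀ k i) (fun _ _ => zero_le)
        (Finset.mem_univ i)
    have hne : (∑ k, s.2 i₀ k i)⁻¹ ≠ ∞ :=
      ENNReal.inv_ne_top.2 (zero_lt_one.trans_le h1).ne'
    have hcont : Continuous fun s : Screen n ι => (∑ k, s.2 i₀ k i)⁻¹ := by fun_prop
    refine ContinuousAt.continuousWithinAt (ContinuousAt.fun_smul ?_ ?_)
    · exact ContinuousAt.comp (x := s) (f := fun s : Screen n ι => (∑ k, s.2 i₀ k i)⁻¹)
        (ENNReal.continuousAt_toReal hne) hcont.continuousAt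
    · exact Continuous.continuousAt (by fun_prop)

theorem sum_dist_pos {n : ℕ} {ι : Type} [Fintype ι] [Nontrivial ι] (i₀ : ι) {c : ι → E n}
    (hc : Injective c) : 0 < ∑ k, dist (c i₀) (c k) := by
  obtain ⟨j, hj⟩ := exists_ne i₀
  exact Finset.sum_pos' (fun _ _ => dist_nonneg) ⟨j, Finset.mem_univ j, dist_pos.2 (hc.ne hj.symm)⟩

theorem sum_norm_shape {n : ℕ} {ι : Type} [Fintype ι] [Nontrivial ι] (i₀ : ι) {s : Screen n ι}
    (hs : s ∈ fmSet n ι) : ∑ i, ‖s.shape i₀ i‖ = 1 := by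
  have hcont : ContinuousOn (fun s : Screen n ι => ∑ i, ‖s.shape i₀ i‖) (fmSet n ι) :=
    continuousOn_finsetSum _ fun i _ => (continuousOn_pi.1 (continuousOn_shape i₀) i).norm
  refine EqOn.of_subset_closure (s := screen '' {c | Injective c}) ?_ hcont continuousOn_const
    subset_closure subset_rfl hs
  rintro _ ⟨c, hc, rfl⟩
  have hpos := sum_dist_pos i₀ hc
  simp only [shape_screen i₀ hc, norm_smul, ← Finset.mul_sum, ← dist_eq_norm, norm_inv]
  rw [Real.norm_of_nonneg hpos.le]
  simp only [dist_comm _ (c i₀)]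
  exact inv_mul_cancel₀ hpos.ne'

/-- The size of a configuration, relative to the point labelled by `i₀`. -/
def spread {n : ℕ} {ι : Type} [Fintype ι] (i₀ : ι) (x : ι → E n) : ℝ := ∑ k, dist (x i₀) (x k)

theorem spread_nonneg {n : ℕ} {ι : Type} [Fintype ι] (i₀ : ι) (x : ι → E n) :
    0 ≤ spread i₀ x := Finset.sum_nonneg fun _ _ => dist_nonneg

theorem continuous_spread {n : ℕ} {ι : Type} [Fintype ι] (i₀ : ι) :
    Continuous (spread (n := n) i₀) := by
  unfold spread
  fun_prop

/-- A point of `F_U(ι)` is determined by the position of one of its points, by its size, and by its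
screen. -/
theorem position_eq {n : ℕ} {ι : Type} [Fintype ι] [Nontrivial ι] (i₀ : ι)
    {U : TopologicalSpace.Opens (E n)} {z : (ι → E n) × Screen n ι} (hz : z ∈ fmModSet U ι)
    (i : ι) : z.1 i = z.1 i₀ + spread i₀ z.1 • z.2.shape i₀ i := by
  -- both sides are continuous, and agree on honest configurations, which are dense
  have hc1 : ContinuousOn (fun z : (ι → E n) × Screen n ι => z.1 i) (fmModSet U ι) :=
    Continuous.continuousOn (by fun_prop)
  have hc2 : ContinuousOn (fun z : (ι → E n) × Screen n ι =>
      z.1 i₀ + spread i₀ z.1 • z.2.shape i₀ i) (fmModSet U ι) := by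
    refine ContinuousOn.fun_add (Continuous.continuousOn (by fun_prop)) (ContinuousOn.fun_smul ?_ ?_)
    · exact ((continuous_spread i₀).comp continuous_fst).continuousOn
    · exact (continuousOn_pi.1 (continuousOn_shape i₀) i).comp continuousOn_snd
        fun z hz => fmModSet_screen_mem hz
  refine EqOn.of_subset_closure
    (s := (fun c => (c, screen c)) '' {c | Injective c ∧ ∀ i, c i ∈ U}) ?_ hc1 hc2 ?_
    (fun z hz => hz.2) hz
  · rintro _ ⟨c, hc, rfl⟩
    have hpos := sum_dist_pos i₀ hc.1
    simp only [shape_screen i₀ hc.1, spread]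
    rw [smul_inv_smul₀ hpos.ne', add_sub_cancel]
  · rintro _ ⟨c, hc, rfl⟩
    exact ⟨hc.2, subset_closure ⟨c, hc, rfl⟩⟩

theorem screen_add_smul {n : ℕ} {ι : Type} (c : ι → E n) (y : E n) {r : ℝ} (hr : 0 < r) :
    screen (fun i => y + r • c i) = screen c := by
  refine Prod.ext ?_ ?_
  · funext i j
    simp only [screen, add_sub_add_left_eq_sub, ← smul_sub, norm_smul, smul_smul,
      Real.norm_of_nonneg hr.le]
    congr 1
    field_simp
  · funext i j k
    simp only [screen, edist_eq_enorm_sub, add_sub_add_left_eq_sub, ← smul_sub, enorm_smul]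
    exact ENNReal.mul_div_mul_left _ _ (by simpa using hr.ne') (by simp)

/-- Conversely, every screen occurs with every position and size that keep the points in `U`. -/
theorem mem_fmModSet_of_shape {n : ℕ} {ι : Type} [Fintype ι] [Nontrivial ι] (i₀ : ι)
    {U : TopologicalSpace.Opens (E n)} {s : Screen n ι} (hs : s ∈ fmSet n ι) (y : E n) {r : ℝ}
    (hr : 0 ≤ r) (hU : ∀ i, y + r • s.shape i₀ i ∈ U) :
    (fun i => y + r • s.shape i₀ i, s) ∈ fmModSet U ι := by
  refine ⟨hU, ?_⟩
  have pos : ∀ r : ℝ, 0 < r → (∀ i, y + r • s.shape i₀ i ∈ U) →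
      (fun i => y + r • s.shape i₀ i, s) ∈
        closure ((fun c => (c, screen c)) '' {c : ι → E n | Injective c ∧ ∀ i, c i ∈ U}) := by
    intro r hr hU
    have hne : (𝓝[screen '' {c : ι → E n | Injective c}] s).NeBot :=
      mem_closure_iff_nhdsWithin_neBot.1 hs
    have hd : Tendsto (fun s : Screen n ι => s.shape i₀)
        (𝓝[screen '' {c : ι → E n | Injective c}] s) (𝓝 (s.shape i₀)) :=
      ((continuousOn_shape i₀) s hs).mono subset_closure
    have hx : Tendsto (fun s : Screen n ι => fun i => y + r • s.shape i₀ i)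
        (𝓝[screen '' {c : ι → E n | Injective c}] s) (𝓝 fun i => y + r • s.shape i₀ i) :=
      tendsto_pi_nhds.2 fun i => ((tendsto_pi_nhds.1 hd i).const_smul r).const_add y
    refine mem_closure_of_tendsto (hx.prodMk_nhds (tendsto_id.mono_left nhdsWithin_le_nhds)) ?_
    have hev : ∀ᶠ s' in 𝓝[screen '' {c : ι → E n | Injective c}] s,
        ∀ i, y + r • s'.shape i₀ i ∈ U :=
      eventually_all.2 fun i =>
        (tendsto_pi_nhds.1 hx i).eventually_mem (U.isOpen.mem_nhds (hU i))
    filter_upwards [hev, self_mem_nhdsWithin] with s' h1 h2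
    obtain ⟨c, hc, rfl⟩ := h2
    have hpos := sum_dist_pos i₀ hc
    have hform : (fun i => y + r • (screen c).shape i₀ i) =
        fun i => (y - (r * (∑ k, dist (c i₀) (c k))⁻¹) • c i₀) +
          (r * (∑ k, dist (c i₀) (c k))⁻¹) • c i := by
      funext i
      rw [shape_screen i₀ hc, smul_smul, smul_sub]
      abel
    have hr' : 0 < r * (∑ k, dist (c i₀) (c k))⁻¹ := mul_pos hr (inv_pos.2 hpos)
    refine ⟨fun i => y + r • (screen c).shape i₀ i, ⟨?_, h1⟩, Prod.ext rfl ?_⟩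
    · rw [hform]
      intro i j hij
      exact hc (smul_right_injective _ hr'.ne' (add_left_cancel hij))
    · change screen (fun i => y + r • (screen c).shape i₀ i) = screen c
      rw [hform]
      exact screen_add_smul c _ hr'
  rcases hr.eq_or_lt with rfl | hr
  · -- a configuration of size zero is a limit of configurations of small positive size
    rw [← closure_closure]
    have hx : Tendsto (fun r : ℝ => fun i => y + r • s.shape i₀ i) (𝓝[>] 0)
        (𝓝 fun i => y + (0 : ℝ) • s.shape i₀ i) := by
      have : Continuous fun r : ℝ => fun i => y + r • s.shape i₀ i := by fun_prop
      exact (this.tendsto 0).mono_left nhdsWithin_le_nhds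
    refine mem_closure_of_tendsto (hx.prodMk_nhds tendsto_const_nhds) ?_
    have hev : ∀ᶠ r in 𝓝[>] (0 : ℝ), ∀ i, y + r • s.shape i₀ i ∈ U :=
      eventually_all.2 fun i =>
        (tendsto_pi_nhds.1 hx i).eventually_mem (U.isOpen.mem_nhds (hU i))
    filter_upwards [hev, self_mem_nhdsWithin] with r h1 h2
    exact pos r h2 h1
  · exact pos r hr hU

/-! ### Expansion of configurations -/

/-- Increase the size of a configuration by `τ`, keeping the point labelled by `i₀` and the screen
fixed. -/
def expand {n : ℕ} {ι : Type} [Fintype ι] (i₀ : ι) (τ : ℝ) (z : (ι → E n) × Screen n ι) :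
    (ι → E n) × Screen n ι :=
  (fun i => z.1 i + τ • z.2.shape i₀ i, z.2)

theorem expand_expand {n : ℕ} {ι : Type} [Fintype ι] (i₀ : ι) (τ σ : ℝ)
    (z : (ι → E n) × Screen n ι) : expand i₀ σ (expand i₀ τ z) = expand i₀ (τ + σ) z := by
  refine Prod.ext (funext fun i => ?_) rfl
  simp only [expand, add_smul, add_assoc]

theorem expand_zero {n : ℕ} {ι : Type} [Fintype ι] (i₀ : ι) (z : (ι → E n) × Screen n ι) :
    expand i₀ 0 z = z := by
  simp [expand]

theorem expand_apply {n : ℕ} {ι : Type} [Fintype ι] [Nontrivial ι] (i₀ : ι)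
    {U : TopologicalSpace.Opens (E n)} {z : (ι → E n) × Screen n ι} (hz : z ∈ fmModSet U ι)
    (τ : ℝ) (i : ι) :
    (expand i₀ τ z).1 i = z.1 i₀ + (spread i₀ z.1 + τ) • z.2.shape i₀ i := by
  simp only [expand]
  rw [position_eq i₀ hz i, add_smul, add_assoc]

theorem expand_mem {n : ℕ} {ι : Type} [Fintype ι] [Nontrivial ι] (i₀ : ι)
    {U : TopologicalSpace.Opens (E n)} {z : (ι → E n) × Screen n ι} (hz : z ∈ fmModSet U ι)
    {τ : ℝ} (hτ : 0 ≤ spread i₀ z.1 + τ) (hU : ∀ i, (expand i₀ τ z).1 i ∈ U) :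
    expand i₀ τ z ∈ fmModSet U ι := by
  have h : expand i₀ τ z = (fun i => z.1 i₀ + (spread i₀ z.1 + τ) • z.2.shape i₀ i, z.2) :=
    Prod.ext (funext fun i => expand_apply i₀ hz τ i) rfl
  rw [h]
  exact mem_fmModSet_of_shape i₀ (fmModSet_screen_mem hz) _ hτ fun i => by
    rw [← expand_apply i₀ hz]
    exact hU i

theorem spread_expand {n : ℕ} {ι : Type} [Fintype ι] [Nontrivial ι] (i₀ : ι)
    {U : TopologicalSpace.Opens (E n)} {z : (ι → E n) × Screen n ι} (hz : z ∈ fmModSet U ι)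
    {τ : ℝ} (hτ : 0 ≤ spread i₀ z.1 + τ) :
    spread i₀ (expand i₀ τ z).1 = spread i₀ z.1 + τ := by
  have hs := fmModSet_screen_mem hz
  rw [spread]
  simp only [expand_apply i₀ hz, shape_base i₀ hs, smul_zero, add_zero, dist_self_add_right,
    norm_smul, Real.norm_of_nonneg hτ]
  rw [← Finset.mul_sum, sum_norm_shape i₀ hs, mul_one]

theorem expand_mem_of_convex {n : ℕ} {ι : Type} [Fintype ι] [Nontrivial ι] (i₀ : ι)
    {U : TopologicalSpace.Opens (E n)} (hconv : Convex ℝ (U : Set (E n)))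
    {z : (ι → E n) × Screen n ι} (hz : z ∈ fmModSet U ι) {τ : ℝ} (hτ : 0 ≤ spread i₀ z.1 + τ)
    (hτ0 : τ ≤ 0) : expand i₀ τ z ∈ fmModSet U ι := by
  refine expand_mem i₀ hz hτ fun i => ?_
  rcases (spread_nonneg i₀ z.1).eq_or_lt with h0 | h0
  · obtain rfl : τ = 0 := le_antisymm hτ0 (by rwa [← h0, zero_add] at hτ)
    rw [expand_zero]
    exact hz.1 i
  · have h1 : (expand i₀ τ z).1 i =
        z.1 i₀ + ((spread i₀ z.1 + τ) / spread i₀ z.1) • (z.1 i - z.1 i₀) := by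
      rw [expand_apply i₀ hz, position_eq i₀ hz i, add_sub_cancel_left, smul_smul,
        div_mul_cancel₀ _ h0.ne']
    rw [h1]
    exact hconv.add_smul_sub_mem (hz.1 i₀) (hz.1 i)
      ⟨div_nonneg hτ h0.le, (div_le_one h0).2 (by linarith)⟩

theorem continuous_expand {n : ℕ} {ι : Type} [Fintype ι] (i₀ : ι)
    {U : TopologicalSpace.Opens (E n)} :
    Continuous fun p : fmModSet U ι × ℝ => expand i₀ p.2 p.1.1 := by
  have hd : Continuous fun p : fmModSet U ι × ℝ => p.1.1.2.shape i₀ :=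
    (continuousOn_shape i₀).comp_continuous (by fun_prop) fun p => fmModSet_screen_mem p.1.2
  refine Continuous.prodMk (continuous_pi fun i => ?_) (by fun_prop)
  have := (continuous_pi_iff.1 hd) i
  fun_prop

/-! ### Contraction of the compactified configuration spaces -/

open Classical in
/-- A partially defined map with open domain extends by `∞` to the one-point compactification, if
the preimages of compact sets are closed. -/
theorem continuous_dite_infty {A Y : Type} [TopologicalSpace A] [TopologicalSpace Y] {D : Set A}
    (hD : IsOpen D) (g : D → Y) (hg : Continuous g)
    (hK : ∀ K : Set Y, IsCompact K → IsClosed K → IsClosed (Subtype.val '' (g ⁻¹' K))) :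
    Continuous fun a => if h : a ∈ D then (g ⟨a, h⟩ : OnePoint Y) else OnePoint.infty := by
  rw [continuous_iff_continuousAt]
  intro a
  by_cases ha : a ∈ D
  · refine (hD.isOpenEmbedding_subtypeVal.continuousAt_iff (x := (⟨a, ha⟩ : D))).1 ?_
    have : (fun a => if h : a ∈ D then (g ⟨a, h⟩ : OnePoint Y) else OnePoint.infty) ∘
        (Subtype.val : D → A) = fun x : D => (g x : OnePoint Y) := by
      funext x
      exact dif_pos x.2
    rw [this]
    exact (OnePoint.continuous_coe.comp hg).continuousAt
  · rw [ContinuousAt, dif_neg ha, OnePoint.hasBasis_nhds_infty.tendsto_right_iff]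
    rintro K ⟨hKc, hKK⟩
    have hmem : (Subtype.val '' (g ⁻¹' K))ᶜ ∈ 𝓝 a :=
      (hK K hKK hKc).isOpen_compl.mem_nhds fun ⟨x, _, hx⟩ => ha (hx ▸ x.2)
    filter_upwards [hmem] with b hb
    split_ifs with h
    · exact Or.inl ⟨_, fun hk => hb ⟨⟨b, h⟩, hk, rfl⟩, rfl⟩
    · exact Or.inr rfl

theorem continuous_onePoint_elim {X Y T : Type} [TopologicalSpace X] [T2Space X]
    [TopologicalSpace Y] [TopologicalSpace T] (f : X → T → OnePoint Y)
    (hf : Continuous fun p : X × T => f p.1 p.2)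
    (hK : ∀ K : Set Y, IsCompact K → IsClosed K →
      ∃ C : Set X, IsCompact C ∧ ∀ x t, f x t ∈ ((↑) '' K : Set (OnePoint Y)) → x ∈ C) :
    Continuous fun p : OnePoint X × T => p.1.elim OnePoint.infty fun x => f x p.2 := by
  rw [continuous_iff_continuousAt]
  rintro ⟨u, t⟩
  induction u using OnePoint.rec with
  | infty =>
    rw [ContinuousAt, OnePoint.elim_infty, OnePoint.hasBasis_nhds_infty.tendsto_right_iff]
    rintro K ⟨hKc, hKK⟩
    obtain ⟨C, hC, hCK⟩ := hK K hKK hKc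
    have hN := OnePoint.hasBasis_nhds_infty.mem_of_mem (i := C) ⟨hC.isClosed, hC⟩
    filter_upwards [prod_mem_nhds hN (univ_mem (f := 𝓝 t))]
    rintro ⟨u, t'⟩ ⟨hu, -⟩
    rcases hu with ⟨x, hx, rfl⟩ | hu
    · change f x t' ∈ _
      rcases h : f x t' with _ | y
      · exact Or.inr rfl
      · exact Or.inl ⟨y, fun hy => hx (hCK x t' (h ▸ mem_image_of_mem _ hy)), rfl⟩
    · obtain rfl : u = OnePoint.infty := hu
      exact Or.inr rfl
  | coe x =>
    have ho : IsOpenEmbedding (Prod.map ((↑) : X → OnePoint X) (id : T → T)) :=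
      OnePoint.isOpenEmbedding_coe.prodMap IsOpenEmbedding.id
    refine (ho.continuousAt_iff (x := (x, t))).1 ?_
    exact hf.continuousAt

/-- The expansion is proper: by convexity of `U`, it can be undone on a closed set. -/
theorem isCompact_expand_preimage {n : ℕ} {ι : Type} [Fintype ι] [Nontrivial ι] (i₀ : ι)
    {U : TopologicalSpace.Opens (E n)} (hconv : Convex ℝ (U : Set (E n))) {c : ℝ} (hc : 0 ≤ c)
    {K : Set (fmModSet U ι)} (hK : IsCompact K) :
    IsCompact {p : fmModSet U ι × unitInterval |
      ∃ w ∈ K, expand i₀ (c * p.2) p.1.1 = w.1} := by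
  let S : Set (fmModSet U ι × unitInterval) := {p | 0 ≤ spread i₀ p.1.1.1 + -(c * p.2)}
  have hS : IsClosed S := by
    refine isClosed_le continuous_const (Continuous.add ?_ (by fun_prop))
    exact (continuous_spread i₀).comp (by fun_prop)
  have hc0 : ∀ t : unitInterval, 0 ≤ c * t := fun t => mul_nonneg hc t.2.1
  -- the inverse of the expansion, defined where the size does not become negative
  let back : S → fmModSet U ι × unitInterval := fun p =>
    (⟨expand i₀ (-(c * p.1.2)) p.1.1.1,
      expand_mem_of_convex i₀ hconv p.1.1.2 p.2 (neg_nonpos.2 (hc0 _))⟩, p.1.2)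
  have hback : Continuous back := by
    refine Continuous.prodMk (Continuous.subtype_mk ?_ _) (by fun_prop)
    have h : Continuous fun p : S => (p.1.1, -(c * (p.1.2 : ℝ))) := by fun_prop
    exact (continuous_expand i₀).comp h
  have hcomp : IsCompact (back '' (Subtype.val ⁻¹' (K ×ˢ univ))) :=
    ((hS.isClosedEmbedding_subtypeVal).isCompact_preimage (hK.prod isCompact_univ)).image hback
  convert hcomp using 1
  refine Subset.antisymm ?_ ?_
  · rintro ⟨z, t⟩ ⟨w, hw, hzw⟩
    dsimp only at hzw
    have hsp : spread i₀ w.1.1 = spread i₀ z.1.1 + c * t := by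
      rw [← hzw]
      exact spread_expand i₀ z.2 (add_nonneg (spread_nonneg _ _) (hc0 t))
    have hwS : (w, t) ∈ S := by
      change 0 ≤ spread i₀ w.1.1 + -(c * t)
      rw [hsp, add_neg_cancel_right]
      exact spread_nonneg _ _
    refine ⟨⟨(w, t), hwS⟩, ⟨hw, trivial⟩, Prod.ext (Subtype.ext ?_) rfl⟩
    change expand i₀ (-(c * t)) w.1 = z.1
    rw [← hzw, expand_expand, add_neg_cancel, expand_zero]
  · rintro _ ⟨⟨⟨w, t⟩, hwS⟩, ⟨hw, -⟩, rfl⟩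
    refine ⟨w, hw, ?_⟩
    change expand i₀ (c * t) (expand i₀ (-(c * t)) w.1) = w.1
    rw [expand_expand, neg_add_cancel, expand_zero]

open Classical in
/-- The expansion of configurations in `U` at time `t`, with speed `c`, where the configurations
that leave `U` go to infinity. -/
def expandAt {n : ℕ} {ι : Type} [Fintype ι] [Nontrivial ι] (i₀ : ι)
    {U : TopologicalSpace.Opens (E n)} {c : ℝ} (hc : 0 ≤ c) (z : fmModSet U ι)
    (t : unitInterval) : OnePoint (fmModSet U ι) :=
  if h : ∀ i, (expand i₀ (c * t) z.1).1 i ∈ U then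
    ((⟨expand i₀ (c * t) z.1,
        expand_mem i₀ z.2 (add_nonneg (spread_nonneg _ _) (mul_nonneg hc t.2.1)) h⟩ :
      fmModSet U ι) : OnePoint (fmModSet U ι))
  else OnePoint.infty

theorem expandAt_eq_coe {n : ℕ} {ι : Type} [Fintype ι] [Nontrivial ι] {i₀ : ι}
    {U : TopologicalSpace.Opens (E n)} {c : ℝ} {hc : 0 ≤ c} {z w : fmModSet U ι}
    {t : unitInterval} (h : expandAt i₀ hc z t = w) : expand i₀ (c * t) z.1 = w.1 := by
  unfold expandAt at h
  split_ifs at h with h'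
  · exact congrArg Subtype.val (OnePoint.coe_injective h)
  · exact absurd h.symm (OnePoint.coe_ne_infty w)

theorem continuous_expandAt {n : ℕ} {ι : Type} [Fintype ι] [Nontrivial ι] (i₀ : ι)
    {U : TopologicalSpace.Opens (E n)} (hconv : Convex ℝ (U : Set (E n))) {c : ℝ} (hc : 0 ≤ c) :
    Continuous fun p : fmModSet U ι × unitInterval => expandAt i₀ hc p.1 p.2 := by
  have hexp : Continuous fun p : fmModSet U ι × unitInterval => expand i₀ (c * p.2) p.1.1 := by
    have h : Continuous fun p : fmModSet U ι × unitInterval => (p.1, c * (p.2 : ℝ)) := by fun_prop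
    exact (continuous_expand i₀).comp h
  let D : Set (fmModSet U ι × unitInterval) := {p | ∀ i, (expand i₀ (c * p.2) p.1.1).1 i ∈ U}
  have hD : IsOpen D := by
    dsimp only [D]
    rw [ofPred_forall]
    refine isOpen_iInter_of_finite fun i => U.isOpen.preimage ?_
    exact (continuous_apply i).comp (continuous_fst.comp hexp)
  let g : D → fmModSet U ι := fun p => ⟨expand i₀ (c * p.1.2) p.1.1.1, expand_mem i₀ p.1.1.2
    (add_nonneg (spread_nonneg _ _) (mul_nonneg hc p.1.2.2.1)) p.2⟩
  refine (continuous_dite_infty hD g ?_ fun K hK _ => ?_).congr fun p => ?_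
  · exact Continuous.subtype_mk (hexp.comp continuous_subtype_val) _
  · convert (isCompact_expand_preimage i₀ hconv hc hK).isClosed using 1
    refine Subset.antisymm ?_ ?_
    · rintro _ ⟨p, hp, rfl⟩
      exact ⟨_, hp, rfl⟩
    · rintro p ⟨w, hw, hpw⟩
      refine ⟨⟨p, fun i => ?_⟩, ?_, rfl⟩
      · rw [hpw]
        exact w.2.1 i
      · rw [mem_preimage]
        convert hw
        exact Subtype.ext hpw
  · unfold expandAt
    split_ifs with h1 h2 h2
    · rfl
    · exact absurd h1 h2
    · exact absurd h2 h1
    · rfl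

theorem exists_spread_le {n : ℕ} {ι : Type} [Fintype ι] (i₀ : ι)
    {U : TopologicalSpace.Opens (E n)} (hb : Bornology.IsBounded (U : Set (E n))) :
    ∃ b, 0 ≤ b ∧ ∀ z : fmModSet U ι, spread i₀ z.1.1 ≤ b := by
  refine ⟨∑ _ : ι, Metric.diam (U : Set (E n)), Finset.sum_nonneg fun _ _ => Metric.diam_nonneg,
    fun z => Finset.sum_le_sum fun k _ => ?_⟩
  exact Metric.dist_le_diam_of_mem hb (z.2.1 i₀) (z.2.1 k)

/-- For bounded convex `U` and `|ι| ≥ 2`, the identity of `F_U(ι)⁺` is pointed null-homotopic: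
expansion takes every configuration to infinity, including those that are infinitesimal. -/
theorem fmModule_homotopic_const {n : ℕ} {U : TopologicalSpace.Opens (E n)}
    (hconv : Convex ℝ (U : Set (E n))) (hb : Bornology.IsBounded (U : Set (E n)))
    (ι : Type) [Finite ι] [Nontrivial ι] :
    (PtMap.id (onePt (fmModSet U ι))).Homotopic
      ⟨fun _ => (onePt (fmModSet U ι)).base, continuous_const, rfl⟩ := by
  cases nonempty_fintype ι
  let i₀ : ι := Classical.arbitrary ι
  obtain ⟨b, hb0, hbz⟩ := exists_spread_le (ι := ι) i₀ hb
  -- all sizes are at most `b`, so that the expansion by `b + 1` leaves no configuration in `U`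
  have hc : 0 ≤ b + 1 := by linarith
  have hcont := continuous_onePoint_elim (expandAt i₀ hc) (continuous_expandAt i₀ hconv hc)
    fun K hK _ => ⟨Prod.fst '' _, (isCompact_expand_preimage i₀ hconv hc hK).image continuous_fst,
      fun z t ⟨w, hw, hzw⟩ => ⟨(z, t), ⟨w, hw, expandAt_eq_coe hzw.symm⟩, rfl⟩⟩
  refine ⟨pathSpace.lift (X := onePt (fmModSet U ι)) (Y := onePt (fmModSet U ι))
    (fun u t => OnePoint.elim u OnePoint.infty fun z => expandAt i₀ hc z t) hcont fun t => rfl,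
    fun u => ?_⟩
  induction u using OnePoint.rec with
  | infty => exact ⟨rfl, rfl⟩
  | coe z =>
    constructor
    · change expandAt i₀ hc z 0 = z
      have h0 : expand i₀ ((b + 1) * (0 : unitInterval)) z.1 = z.1 := by
        rw [Icc.coe_zero, mul_zero, expand_zero]
      rw [expandAt, dif_pos fun i => by
        rw [h0]
        exact z.2.1 i]
      exact congrArg OnePoint.some (Subtype.ext h0)
    · change expandAt i₀ hc z 1 = OnePoint.infty
      rcases h : expandAt i₀ hc z 1 with _ | w
      · rfl
      · have h1 := expandAt_eq_coe h
        rw [Icc.coe_one, mul_one] at h1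
        have h2 := spread_expand i₀ z.2 (add_nonneg (spread_nonneg _ _) hc)
        rw [h1] at h2
        linarith [hbz w, spread_nonneg i₀ z.1.1]

theorem contractibleSpace_of_homotopic_const {X : PtSpace}
    (h : (PtMap.id X).Homotopic ⟨fun _ => X.base, continuous_const, rfl⟩) :
    ContractibleSpace X :=
  (contractible_iff_id_nullhomotopic X).2 ⟨X.base, h.toContinuousMap⟩

/-! ### The map of right modules -/

theorem nonempty_ptHomeo_ballPlus_sphere (n : ℕ) : Nonempty (PtHomeo (ballPlus n) (sphere n)) := by
  let v : E (n + 1) := EuclideanSpace.single 0 1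
  have hv : ‖v‖ = 1 := by simp [v]
  have hv0 : v ≠ 0 := fun h => by simp [h] at hv
  have : Fact (Module.finrank ℝ (E (n + 1)) = n + 1) := ⟨by simp⟩
  have hdim : Module.finrank ℝ (E n) = Module.finrank ℝ (Submodule.span ℝ {v})ᗮ := by
    rw [Submodule.finrank_orthogonal_span_singleton (n := n) hv0]
    simp
  let e : E n ≃ₜ (Submodule.span ℝ {v})ᗮ :=
    (FiniteDimensional.nonempty_continuousLinearEquiv_of_finrank_eq hdim).some.toHomeomorph
  let b : ball n ≃ₜ E n := Homeomorph.unitBall.symm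
  refine ⟨⟨(b.trans e).onePointCongr.trans (onePointHyperplaneHomeoUnitSphere hv), ?_⟩⟩
  exact OnePoint.equivOfIsEmbeddingOfRangeEq_apply_infty (X := (Submodule.span ℝ {v})ᗮ)
    (Y := Metric.sphere (0 : E (n + 1)) 1) _ _ (isOpenEmbedding_stereographic_symm hv).toIsEmbedding
    (range_stereographic_symm hv)

/-- A configuration of one point is the position of this point. -/
def fmModHomeoOfSubsingleton {n : ℕ} (U : TopologicalSpace.Opens (E n)) {ι : Type}
    [Subsingleton ι] (i : ι) : fmModSet U ι ≃ₜ U where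
  toFun z := ⟨z.1.1 i, z.2.1 i⟩
  invFun y := ⟨(fun _ => y.1, 0), fun _ => y.2, subset_closure ⟨fun _ => y.1,
    ⟨fun _ _ _ => Subsingleton.elim _ _, fun _ => y.2⟩, by
      refine Prod.ext rfl (Prod.ext ?_ ?_)
      · funext j k
        simp [screen]
      · funext j k l
        simp [screen]⟩⟩
  left_inv z := by
    have hz := fmModSet_screen_mem z.2
    refine Subtype.ext (Prod.ext ?_ (Prod.ext ?_ ?_))
    · funext j
      rw [Subsingleton.elim j i]
    · funext j k
      rw [Subsingleton.elim k j]
      exact (fmSet_diag hz j).1.symm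
    · funext j k l
      rw [Subsingleton.elim k j, Subsingleton.elim l j]
      exact (fmSet_diag hz j).2.symm
  right_inv y := rfl
  continuous_toFun := by fun_prop
  continuous_invFun := by fun_prop

theorem subsingleton_sphereTriv (n : ℕ) (ι : Type) [Finite ι] [Nonempty ι] [Nontrivial ι] :
    Subsingleton ((sphereTriv n).obj ι) := by
  have hbase : ∀ z : smash (sphere n) ((sigmaSeq 1).obj ι),
      z = (smash (sphere n) ((sigmaSeq 1).obj ι)).base := by
    intro z
    induction z using smash.ind with
    | h x y =>
      rcases y with e | y
      · exact absurd e.symm.injective.subsingleton (not_subsingleton ι)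
      · exact smash.mk_base_right x
  exact ⟨fun z w => (hbase z).trans (hbase w).symm⟩

/-- The bijection from the standard one-element set. -/
def finOneEquiv (ι : Type) [Nonempty ι] [Subsingleton ι] : Fin 1 ≃ ι where
  toFun _ := Classical.arbitrary ι
  invFun _ := 0
  left_inv _ := Subsingleton.elim _ _
  right_inv _ := Subsingleton.elim _ _

/-- The homeomorphism from `F_{(Bⁿ)⁺}(ι)` to `Sⁿ` for a one-element set `ι`. -/
def onePtHomeoSphere {n : ℕ} (h : PtHomeo (ballPlus n) (sphere n)) (ι : Type) [Nonempty ι]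
    [Subsingleton ι] : OnePoint (fmModSet (ball n) ι) ≃ₜ sphere n :=
  (fmModHomeoOfSubsingleton (ball n) (Classical.arbitrary ι)).onePointCongr.trans h.toHomeomorph

open Classical in
/-- The components of the map of modules. -/
def collapseApp {n : ℕ} (h : PtHomeo (ballPlus n) (sphere n)) (ι : Type) [Finite ι] [Nonempty ι] :
    PtMap (onePt (fmModSet (ball n) ι)) (smash (sphere n) ((sigmaSeq 1).obj ι)) :=
  if _ : Subsingleton ι then
    { toFun := fun u => smash.mk (onePtHomeoSphere h ι u) (Sum.inl (finOneEquiv ι))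
      cont := smash.continuous_mk.comp
        ((onePtHomeoSphere h ι).continuous.prodMk continuous_const)
      map_base' := (congrArg (fun x => smash.mk x _) h.map_base).trans (smash.mk_base_left _) }
  else ⟨fun _ => (smash _ _).base, continuous_const, rfl⟩

theorem collapseApp_apply {n : ℕ} (h : PtHomeo (ballPlus n) (sphere n)) (ι : Type) [Finite ι]
    [Nonempty ι] [hι : Subsingleton ι] (u : onePt (fmModSet (ball n) ι)) :
    collapseApp h ι u = smash.mk (onePtHomeoSphere h ι u) (Sum.inl (finOneEquiv ι)) := by
  rw [collapseApp, dif_pos hι]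
  rfl

theorem collapseApp_isHomotopyEquiv {n : ℕ} (h : PtHomeo (ballPlus n) (sphere n)) (ι : Type)
    [Finite ι] [Nonempty ι] : (collapseApp h ι).IsHomotopyEquiv := by
  rcases subsingleton_or_nontrivial ι with hι | hι
  · let _ : TopologicalSpace (Fin 1 ≃ ι) := ⊥
    let g : PtMap (smash (sphere n) ((sigmaSeq 1).obj ι)) (onePt (fmModSet (ball n) ι)) :=
      smash.desc
        (fun x y => Sum.elim (fun _ => (onePtHomeoSphere h ι).symm x) (fun _ => OnePoint.infty) y)
        (continuous_prod_sum (A := sphere n) (B := Fin 1 ≃ ι) (C := Unit)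
          ((onePtHomeoSphere h ι).symm.continuous.comp continuous_fst) continuous_const)
        (fun y => by
          rcases y with y | y
          · exact ((onePtHomeoSphere h ι).symm_apply_eq).2 h.map_base.symm
          · rfl)
        (fun x => rfl)
    have hgf : g.comp (collapseApp h ι) = PtMap.id _ := PtMap.ext fun u => by
      change g (collapseApp h ι u) = u
      rw [collapseApp_apply]
      exact (onePtHomeoSphere h ι).symm_apply_apply u
    have hfg : (collapseApp h ι).comp g = PtMap.id _ := PtMap.ext fun z => by
      induction z using smash.ind with
      | h x y =>
        rcases y with e | y
        · change collapseApp h ι ((onePtHomeoSphere h ι).symm x) = smash.mk x (Sum.inl e)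
          refine (collapseApp_apply h ι _).trans (congrArg₂ smash.mk ?_ (congrArg Sum.inl
            (Equiv.ext fun i => Subsingleton.elim _ _)))
          exact (onePtHomeoSphere h ι).apply_symm_apply x
        · change collapseApp h ι (onePt _).base = smash.mk x ((sigmaSeq 1).obj ι).base
          rw [PtMap.map_base, smash.mk_base_right]
    exact ⟨g, hgf ▸ PtMap.Homotopic.refl _, hfg ▸ PtMap.Homotopic.refl _⟩
  · -- a null-homotopic space is pointed homotopy equivalent to the one-point target
    have hsub : Subsingleton (smash (sphere n) ((sigmaSeq 1).obj ι)) := subsingleton_sphereTriv n ι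
    refine ⟨⟨fun _ => (onePt _).base, continuous_const, rfl⟩, ?_, ?_⟩
    · exact (fmModule_homotopic_const (U := ball n) (convex_ball _ _) Metric.isBounded_ball
        ι).symm
    · convert PtMap.Homotopic.refl (PtMap.id (smash (sphere n) ((sigmaSeq 1).obj ι))) using 1
      exact PtMap.ext fun z => Subsingleton.elim _ _

/-- The map of right modules that collapses the configurations of at least two points, and is the
homeomorphism `h` on configurations of one point. -/
def collapse {n : ℕ} (h : PtHomeo (ballPlus n) (sphere n)) :
    (fmModule (ball n)).Hom (sphereTriv n) where
  app ι _ _ := collapseApp h ι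
  naturality {ι ι'} _ _ _ _ e u := by
    rcases subsingleton_or_nontrivial ι with hι | hι
    · have hι' : Subsingleton ι' := e.symm.injective.subsingleton
      refine (collapseApp_apply h ι' _).trans (Eq.trans ?_
        (congrArg ((sphereTriv n).map e) (collapseApp_apply h ι u)).symm)
      refine congrArg₂ smash.mk ?_
        (congrArg Sum.inl (Equiv.ext fun i => Subsingleton.elim _ _))
      induction u using OnePoint.rec with
      | infty => rfl
      | coe z =>
        refine congrArg (fun y => h.toFun (OnePoint.some y)) (Subtype.ext ?_)
        exact congrArg z.1.1 (Subsingleton.elim _ _)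
    · have hι' : Nontrivial ι' := e.symm.surjective.nontrivial
      have := subsingleton_sphereTriv n ι'
      exact Subsingleton.elim _ _
  app_comp {ι J} _ _ _ _ a u y := by
    have := subsingleton_sphereTriv n (Cup a J)
    exact Subsingleton.elim _ _

theorem collapse_extends {n : ℕ} (h : PtHomeo (ballPlus n) (sphere n)) :
    ExtendsIdentification h (collapse h) := by
  intro z
  refine (collapseApp_apply h (Fin 1) (OnePoint.some z)).trans ?_
  refine congrArg₂ smash.mk ?_ (congrArg Sum.inl (Equiv.ext fun i => Subsingleton.elim _ _))
  refine congrArg (fun y => h.toFun (OnePoint.some y)) (Subtype.ext ?_)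
  exact congrArg z.1.1 (Subsingleton.elim _ _)

theorem hom_eq_of_extends {n : ℕ} {h : PtHomeo (ballPlus n) (sphere n)}
    {f g : (fmModule (ball n)).Hom (sphereTriv n)} (hf : ExtendsIdentification h f)
    (hg : ExtendsIdentification h g) : g = f := by
  have h1 : ∀ u, g.app (Fin 1) u = f.app (Fin 1) u := by
    intro u
    induction u using OnePoint.rec with
    | infty => exact (g.app (Fin 1)).map_base.trans (f.app (Fin 1)).map_base.symm
    | coe z => exact (hg z).trans (hf z).symm
  have happ : ∀ (ι : Type) [Finite ι] [Nonempty ι] (u), g.app ι u = f.app ι u := by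
    intro ι _ _ u
    rcases subsingleton_or_nontrivial ι with hι | hι
    · let e := finOneEquiv ι
      have hu : (fmModule (ball n)).map e ((fmModule (ball n)).map e.symm u) = u := by
        rw [← (fmModule (ball n)).map_trans, e.symm_trans_self, (fmModule (ball n)).map_refl]
      rw [← hu, g.naturality, f.naturality, h1]
    · have := subsingleton_sphereTriv n ι
      exact Subsingleton.elim _ _
  cases f
  cases g
  congr 1
  funext ι _ _
  exact PtMap.ext (happ ι)

end

end FultonMacPherson

theorem proposition9 (n : ℕ) :
    Nonempty (PtHomeo (ballPlus n) (sphere n)) ∧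
    (∀ h : PtHomeo (ballPlus n) (sphere n),
      ∃ f : (fmModule (ball n)).Hom (sphereTriv n),
        ExtendsIdentification h f ∧
        (∀ g : (fmModule (ball n)).Hom (sphereTriv n), ExtendsIdentification h g → g = f) ∧
        f.IsWeakEquiv ∧ f.IsTensorNice) ∧
    ∀ (I : Type) [Finite I] [Nontrivial I], ContractibleSpace ((fmModule (ball n)).obj I) := by
  refine ⟨nonempty_ptHomeo_ballPlus_sphere n, fun h => ⟨collapse h, collapse_extends h,
    fun g hg => hom_eq_of_extends (collapse_extends h) hg, fun I _ _ => ?_, fun m I _ _ => ?_⟩,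
    fun I _ _ => ?_⟩
  · exact (collapseApp_isHomotopyEquiv h I).isWeakEquiv
  · exact (RMod.Hom.tensorPow_isHomotopyEquiv (collapse h)
      (fun J _ _ => collapseApp_isHomotopyEquiv h J) m I).isWeakEquiv
  · exact contractibleSpace_of_homotopic_const
      (fmModule_homotopic_const (U := ball n) (convex_ball _ _) Metric.isBounded_ball I)
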